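/- Let $\mathbf K$ be a (not necessarily connected) reductive linear algebraic group over $\mathbb C$ with Lie algebra $\mathfrak k$, and let $\sigma$ be an algebraic automorphism of $\mathbf K$ with $\sigma^2=1$; write $\sigma$ also for its differential $\mathfrak k\to\mathfrak k$. Let $\mathbf C$ be an open subgroup of the fixed point group $\mathbf K^\sigma$ which meets every connected component of $\mathbf K$. Let $\mathfrak q$ be a $\sigma$-split parabolic subalgebra of $\mathfrak k$, that is, a parabolic subalgebra such that $\mathfrak q\cap\sigma(\mathfrak q)$ is a Levi factor of both $\mathfrak q$ and $\sigma(\mathfrak q)$, and let $\mathbf U$ be the unipotent radical of the normalizer of $\mathfrak q$ in $\mathbf K$. Let $F$ be an irreducible algebraic finite-dimensional complex representation of $\mathbf K$ and let $\chi:\mathbf C\to\mathbb C^\times$ be an algebraic character. Then every nonzero linear functional $\varphi:F\to\mathbb C$ satisfying $\varphi(c\cdot v)=\chi(c)\varphi(v)$ for all $c\in\mathbf C$ and $v\in F$ is not identically zero on the space $F^{\mathbf U}$ of $\mathbf U$-fixed vectors. -/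

import Mathlib

open scoped MatrixGroups Topology

noncomputable section

namespace LinAlgGrp

variable {n : ℕ}

/-- A set of invertible complex matrices is Zariski closed in `GL_n(ℂ)` if it is the set of
common zeros of a family of polynomials in the matrix entries. A linear algebraic group
over `ℂ` is a Zariski closed subgroup of some `GL_n(ℂ)`. -/
def IsZariskiClosed (S : Set (GL (Fin n) ℂ)) : Prop :=
  ∃ I : Set (MvPolynomial (Fin n × Fin n) ℂ),
    S = {g : GL (Fin n) ℂ | ∀ p ∈ I, MvPolynomial.eval (fun ij => (g : Matrix (Fin n) (Fin n) ℂ) ij.1 ij.2) p = 0}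

variable (K : Subgroup (GL (Fin n) ℂ))

/-- The function `x ↦ x i j` on `K`. -/
def entry (i j : Fin n) : K → ℂ :=
  fun x => ((x : GL (Fin n) ℂ) : Matrix (Fin n) (Fin n) ℂ) i j

/-- The function `x ↦ (x⁻¹) i j` on `K`. -/
def invEntry (i j : Fin n) : K → ℂ :=
  fun x => (((x⁻¹ : K) : GL (Fin n) ℂ) : Matrix (Fin n) (Fin n) ℂ) i j

/-- The coordinate ring `ℂ[K]`: the algebra of functions on `K` generated by the entries of `x`
and of `x⁻¹`. -/
def coordRing : Subalgebra ℂ (K → ℂ) :=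
  Algebra.adjoin ℂ ({f | ∃ i j, f = entry K i j} ∪ {f | ∃ i j, f = invEntry K i j})

/-- The Zariski topology of `K`, generated by the sets `{f ≠ 0}` for `f ∈ ℂ[K]`. -/
@[reducible] def zariskiTopology : TopologicalSpace K :=
  TopologicalSpace.generateFrom {O | ∃ f ∈ coordRing K, O = {x | f x ≠ 0}}

variable {K}

/-! ### Unipotent radical and reductive groups -/

/-- All elements of `V` are unipotent matrices. -/
def IsUnipotent (V : Subgroup K) : Prop :=
  ∀ v ∈ V, IsNilpotent ((((v : K) : GL (Fin n) ℂ) : Matrix (Fin n) (Fin n) ℂ) - 1)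

/-- The unipotent radical of a (closed) subgroup `H` of `K`: the subgroup generated by all
closed connected unipotent normal subgroups of `H`, that is, the largest one of them. -/
def unipotentRadical (H : Subgroup K) : Subgroup K :=
  sSup {V | V ≤ H ∧ (V.subgroupOf H).Normal ∧
    IsClosed[zariskiTopology K] (V : Set K) ∧ @IsConnected K (zariskiTopology K) (V : Set K) ∧
    IsUnipotent V}

variable (K) in
/-- A (not necessarily connected) reductive linear algebraic group over `ℂ`. -/
structure IsReductive : Prop where
  closed : IsZariskiClosed (K : Set (GL (Fin n) ℂ))
  unipotentRadical_eq_bot : unipotentRadical (⊤ : Subgroup K) = ⊥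

/-! ### Pullback of regular functions -/

/-- A map `K → K` is regular if it pulls back regular functions to regular functions. -/
def IsRegularMap (φ : K → K) : Prop :=
  ∀ f ∈ coordRing K, f ∘ φ ∈ coordRing K

/-- Pullback `f ↦ f ∘ φ` on `ℂ[K]`. -/
def pullback (φ : K → K) (hφ : IsRegularMap φ) : coordRing K →ₐ[ℂ] coordRing K where
  toFun f := ⟨(f : K → ℂ) ∘ φ, hφ _ f.2⟩
  map_one' := rfl
  map_mul' _ _ := rfl
  map_zero' := rfl
  map_add' _ _ := rfl
  commutes' _ := rfl

theorem pullback_apply (φ : K → K) (hφ : IsRegularMap φ) (f : coordRing K) (x : K) :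
    (pullback φ hφ f : K → ℂ) x = (f : K → ℂ) (φ x) := rfl

theorem entry_mem (i j : Fin n) : entry K i j ∈ coordRing K :=
  Algebra.subset_adjoin (Or.inl ⟨i, j, rfl⟩)

theorem invEntry_mem (i j : Fin n) : invEntry K i j ∈ coordRing K :=
  Algebra.subset_adjoin (Or.inr ⟨i, j, rfl⟩)

theorem isRegularMap_of_entries {φ : K → K} (h : ∀ i j, entry K i j ∘ φ ∈ coordRing K)
    (h' : ∀ i j, invEntry K i j ∘ φ ∈ coordRing K) : IsRegularMap φ := by
  intro f hf
  induction hf using Algebra.adjoin_induction with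
  | mem f hf =>
    rcases hf with ⟨i, j, rfl⟩ | ⟨i, j, rfl⟩
    · exact h i j
    · exact h' i j
  | algebraMap r => exact (coordRing K).algebraMap_mem r
  | add f g _ _ hf hg => exact (coordRing K).add_mem hf hg
  | mul f g _ _ hf hg => exact (coordRing K).mul_mem hf hg

theorem isRegularMap_mul_left (g : K) : IsRegularMap (fun x : K => g * x) := by
  refine isRegularMap_of_entries (fun i j => ?_) (fun i j => ?_)
  · have : entry K i j ∘ (fun x : K => g * x) = ∑ k, entry K i k g • entry K k j := by
      funext x
      simp [entry, Matrix.mul_apply]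
    rw [this]
    exact Subalgebra.sum_mem _ fun k _ => (coordRing K).smul_mem (entry_mem k j) _
  · have : invEntry K i j ∘ (fun x : K => g * x) = ∑ k, invEntry K k j g • invEntry K i k := by
      funext x
      simp only [invEntry, Function.comp, mul_inv_rev, Subgroup.coe_mul, Units.val_mul,
        Matrix.mul_apply, Finset.sum_apply, Pi.smul_apply, smul_eq_mul]
      exact Finset.sum_congr rfl fun k _ => mul_comm _ _
    rw [this]
    exact Subalgebra.sum_mem _ fun k _ => (coordRing K).smul_mem (invEntry_mem i k) _

theorem isRegularMap_mul_right (g : K) : IsRegularMap (fun x : K => x * g) := by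
  refine isRegularMap_of_entries (fun i j => ?_) (fun i j => ?_)
  · have : entry K i j ∘ (fun x : K => x * g) = ∑ k, entry K k j g • entry K i k := by
      funext x
      simp only [entry, Function.comp, Subgroup.coe_mul, Units.val_mul,
        Matrix.mul_apply, Finset.sum_apply, Pi.smul_apply, smul_eq_mul]
      exact Finset.sum_congr rfl fun k _ => mul_comm _ _
    rw [this]
    exact Subalgebra.sum_mem _ fun k _ => (coordRing K).smul_mem (entry_mem i k) _
  · have : invEntry K i j ∘ (fun x : K => x * g) = ∑ k, invEntry K i k g • invEntry K k j := by
      funext x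
      simp only [invEntry, Function.comp, mul_inv_rev, Subgroup.coe_mul, Units.val_mul,
        Matrix.mul_apply, Finset.sum_apply, Pi.smul_apply, smul_eq_mul]
    rw [this]
    exact Subalgebra.sum_mem _ fun k _ => (coordRing K).smul_mem (invEntry_mem k j) _

/-! ### The Lie algebra and differentials of automorphisms -/

variable (K) in
/-- The Lie algebra of `K`: the left invariant derivations of `ℂ[K]`, that is, those which
commute with all left translations, under the commutator bracket. -/
def lieAlg : LieSubalgebra ℂ (Derivation ℂ (coordRing K) (coordRing K)) where
  carrier := {D | ∀ (g : K) (f : coordRing K),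
    D (pullback (fun x => g * x) (isRegularMap_mul_left g) f) =
      pullback (fun x => g * x) (isRegularMap_mul_left g) (D f)}
  zero_mem' := by
    intro g f
    simp
  add_mem' := by
    intro D E hD hE g f
    simp only [Derivation.add_apply, map_add, hD g f, hE g f]
  smul_mem' := by
    intro c D hD g f
    simp only [Derivation.smul_apply, map_smul, hD g f]
  lie_mem' := by
    intro D E hD hE g f
    simp only [Derivation.commutator_apply, map_sub]
    rw [hE g f, hD g f, hD g (E f), hE g (D f)]

variable (K) in
/-- Automorphisms of the algebraic group `K`. -/
structure AlgAut extends K ≃* K where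
  regular : IsRegularMap (fun x : K => toMulEquiv x)
  regular_symm : IsRegularMap (fun x : K => toMulEquiv.symm x)

/-- The derivation `f ↦ (D (f ∘ φ)) ∘ φ⁻¹`. -/
def conjDerivation (φ : AlgAut K) (D : Derivation ℂ (coordRing K) (coordRing K)) :
    Derivation ℂ (coordRing K) (coordRing K) :=
  Derivation.mk'
    ((pullback _ φ.regular_symm).toLinearMap ∘ₗ D.toLinearMap ∘ₗ
      (pullback _ φ.regular).toLinearMap)
    (by
      intro f g
      have h : ∀ f : coordRing K,
          pullback _ φ.regular_symm (pullback _ φ.regular f) = f := by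
        intro f
        apply Subtype.ext
        funext x
        simp [pullback_apply]
      simp [h, smul_eq_mul])

theorem conjDerivation_apply (φ : AlgAut K) (D : Derivation ℂ (coordRing K) (coordRing K))
    (f : coordRing K) : conjDerivation φ D f =
      pullback _ φ.regular_symm (D (pullback _ φ.regular f)) := rfl

theorem conjDerivation_mem (φ : AlgAut K) {D : Derivation ℂ (coordRing K) (coordRing K)}
    (hD : D ∈ lieAlg K) : conjDerivation φ D ∈ lieAlg K := by
  intro g f
  rw [conjDerivation_apply, conjDerivation_apply]
  have h1 : pullback _ φ.regular (pullback _ (isRegularMap_mul_left g) f) =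
      pullback _ (isRegularMap_mul_left (φ.toMulEquiv.symm g)) (pullback _ φ.regular f) := by
    apply Subtype.ext
    funext x
    simp [pullback_apply]
  rw [h1, hD]
  apply Subtype.ext
  funext x
  simp [pullback_apply]

/-- The differential `dφ` of an automorphism `φ` of `K`, as an endomorphism of the Lie algebra:
`(dφ D) f = (D (f ∘ φ)) ∘ φ⁻¹`. -/
def differential (φ : AlgAut K) : lieAlg K →ₗ⁅ℂ⁆ lieAlg K where
  toFun D := ⟨conjDerivation φ D, conjDerivation_mem φ D.2⟩
  map_add' D E := by
    apply Subtype.ext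
    ext f
    simp [conjDerivation_apply]
  map_smul' c D := by
    apply Subtype.ext
    ext f
    simp [conjDerivation_apply]
  map_lie' {D E} := by
    have h : ∀ f : coordRing K,
        pullback _ φ.regular (pullback _ φ.regular_symm f) = f := by
      intro f
      apply Subtype.ext
      funext x
      simp [pullback_apply]
    apply Subtype.ext
    apply Derivation.ext
    intro f
    simp [conjDerivation_apply, Derivation.commutator_apply, h]

/-- The inner automorphism `x ↦ g x g⁻¹`. -/
def innerAut (g : K) : AlgAut K where
  toMulEquiv := MulAut.conj g
  regular := by
    intro f hf
    exact isRegularMap_mul_left g _ (isRegularMap_mul_right g⁻¹ f hf)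
  regular_symm := by
    intro f hf
    have := isRegularMap_mul_left g⁻¹ _ (isRegularMap_mul_right g f hf)
    exact this

/-- The adjoint action of `K` on its Lie algebra. -/
def Ad (g : K) : lieAlg K →ₗ⁅ℂ⁆ lieAlg K := differential (innerAut g)

theorem Ad_apply_apply (g : K) (D : lieAlg K) (f : coordRing K) (x : K) :
    (((Ad g D : lieAlg K) : Derivation ℂ (coordRing K) (coordRing K)) f : K → ℂ) x =
      ((D : Derivation ℂ (coordRing K) (coordRing K))
        (pullback _ (innerAut g).regular f) : K → ℂ) (g⁻¹ * x * g) := rfl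

theorem Ad_one (D : lieAlg K) : Ad (1 : K) D = D := by
  apply Subtype.ext
  apply Derivation.ext
  intro f
  apply Subtype.ext
  funext x
  refine (Ad_apply_apply (1 : K) D f x).trans ?_
  have : pullback _ (innerAut (1 : K)).regular f = f := by
    apply Subtype.ext
    funext x
    simp [pullback_apply, innerAut]
  have hx : (1 : K)⁻¹ * x * 1 = x := by group
  rw [this, hx]

theorem Ad_mul (g h : K) (D : lieAlg K) : Ad (g * h) D = Ad g (Ad h D) := by
  apply Subtype.ext
  apply Derivation.ext
  intro f
  apply Subtype.ext
  funext x
  rw [Ad_apply_apply, Ad_apply_apply, Ad_apply_apply]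
  have : pullback _ (innerAut (g * h)).regular f =
      pullback _ (innerAut h).regular (pullback _ (innerAut g).regular f) := by
    apply Subtype.ext
    funext x
    simp [pullback_apply, innerAut]
  have hx : (g * h)⁻¹ * x * (g * h) = h⁻¹ * (g⁻¹ * x * g) * h := by group
  rw [this, hx]

/-- The normalizer of a subalgebra `q` of the Lie algebra in `K`, for the adjoint action. -/
def normalizer (q : LieSubalgebra ℂ (lieAlg K)) : Subgroup K where
  carrier := {g | ∀ D, D ∈ q ↔ Ad g D ∈ q}
  one_mem' := by
    intro D
    rw [Ad_one]
  mul_mem' := by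
    intro g h hg hh D
    rw [Ad_mul, ← hg, ← hh]
  inv_mem' := by
    intro g hg D
    rw [hg (Ad g⁻¹ D), ← Ad_mul, mul_inv_cancel, Ad_one]

/-! ### Parabolic subalgebras and Levi factors -/

section LieAlgebra

variable {L : Type*} [LieRing L] [LieAlgebra ℂ L]

/-- Borel subalgebras are the maximal solvable subalgebras. -/
def IsBorel (b : LieSubalgebra ℂ L) : Prop :=
  Maximal (fun s : LieSubalgebra ℂ L => LieAlgebra.IsSolvable s) b

/-- Parabolic subalgebras are the subalgebras which contain a Borel subalgebra. -/
def IsParabolic (q : LieSubalgebra ℂ L) : Prop :=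
  ∃ b : LieSubalgebra ℂ L, IsBorel b ∧ b ≤ q

/-- The nilpotent radical `[q, rad q]` of a subalgebra `q`, the smallest ideal with reductive
quotient. (For a parabolic subalgebra of a reductive Lie algebra it is the sum of the root spaces
which do not belong to the Levi part; unlike the largest nilpotent ideal, it does not contain
the center of the reductive Lie algebra.) -/
def nilpotentRadical (q : LieSubalgebra ℂ L) : LieIdeal ℂ q :=
  ⁅(⊤ : LieIdeal ℂ q), LieAlgebra.radical ℂ q⁆

/-- The subalgebra `l` is a Levi factor of `q`: a subalgebra of `q` which is a linear complement
of the nilpotent radical of `q` (hence it is isomorphic to the reductive Lie algebra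
`q / [q, rad q]`). -/
def IsLeviFactor (l q : LieSubalgebra ℂ L) : Prop :=
  Disjoint l.toSubmodule ((nilpotentRadical q).toSubmodule.map q.toSubmodule.subtype) ∧
    l.toSubmodule ⊔ (nilpotentRadical q).toSubmodule.map q.toSubmodule.subtype = q.toSubmodule

end LieAlgebra

/-- The subalgebra `q` of the Lie algebra of `K` is parabolic and `σ`-split: `q ∩ σ(q)` is a Levi
factor for both `q` and `σ(q)`. -/
def IsSplitParabolic (σ : AlgAut K) (q : LieSubalgebra ℂ (lieAlg K)) : Prop :=
  IsParabolic q ∧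
    IsLeviFactor (q ⊓ q.map (differential σ)) q ∧
    IsLeviFactor (q ⊓ q.map (differential σ)) (q.map (differential σ))

/-! ### Symmetric subgroups, characters, representations -/

/-- The fixed point group `K^σ`. -/
def fixedSubgroup (σ : AlgAut K) : Subgroup K where
  carrier := {x | σ.toMulEquiv x = x}
  one_mem' := by simp
  mul_mem' := by
    intro x y hx hy
    simp only [Set.mem_ofPred_eq] at hx hy ⊢
    rw [map_mul, hx, hy]
  inv_mem' := by
    intro x hx
    simp only [Set.mem_ofPred_eq] at hx ⊢
    rw [map_inv, hx]

/-- `C` is a subgroup of `H` which is open in `H` for the Zariski topology of `H`. -/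
def IsOpenSubgroupOf (C H : Subgroup K) : Prop :=
  C ≤ H ∧ ∃ O : Set K, IsOpen[zariskiTopology K] O ∧ (C : Set K) = O ∩ H

/-- `C` meets every connected component of `K`. -/
def MeetsEveryComponent (C : Subgroup K) : Prop :=
  ∀ x : K, ((C : Set K) ∩ @connectedComponent K (zariskiTopology K) x).Nonempty

/-- A character of a (closed) subgroup `C` of `K` is algebraic if it is a regular function
on `C`, that is, the restriction of a regular function on `K`. -/
def IsAlgebraicCharacter {C : Subgroup K} (χ : C →* ℂˣ) : Prop :=
  ∃ f ∈ coordRing K, ∀ c : C, ((χ c : ℂˣ) : ℂ) = f (c : K)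

/-- A (finite dimensional) representation of `K` is algebraic if its matrix coefficients
are regular functions. -/
def IsAlgebraicRep {F : Type*} [AddCommGroup F] [Module ℂ F] (ρ : Representation ℂ K F) : Prop :=
  ∀ (l : Module.Dual ℂ F) (v : F), (fun x : K => l (ρ x v)) ∈ coordRing K

end LinAlgGrp

end

/-! Suppose φ vanishes on F^U. Kolchin's theorem, applied inside a nonzero subspace of least
dimension stable under the normalizer of q, gives a nonzero subspace W stable under the normalizer
and contained in F^U (`exists_stable_fixed_unipotentRadical`), so φ kills W. Such a W is stable
under q. The split condition enters only through the decomposition k = q + k^σ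
(`exists_add_fixed_of_split`): because of it, the k^σ-submodule M generated by W is stable under all
of k (`apply_mem_sInf_stable`). As φ is a C-eigenvector, ker φ is k^σ-stable and hence contains M.
The identity component preserves M and C meets every component, so φ kills ρ(x)M for every x in K.
Thus ker φ contains a nonzero subrepresentation, and irreducibility forces φ = 0.

The decomposition rests on the trace form B of the tautological representation. For a parabolic q
one has q^⊥ ⊆ [q, rad q] (`IsParabolic.mem_nilpotentRadical_of_orthogonal`). An element orthogonal
to q and σ(q) therefore lies both in q ∩ σ(q) and in the nilpotent radical of q, which meet in 0;
nondegeneracy of B gives q + σ(q) = k, and a + σ(b) = (a - b) + (b + σ(b)).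

Nondegeneracy of B is where reductivity is used (`IsReductive.traceForm_nondegenerate`). The Lie
algebra of an algebraic group contains replicas of its elements, so the kernel of B consists of
nilpotent elements. By Engel's theorem it acts strictly triangularly along a K-stable flag. The
elements of K acting trivially on the quotients of the flag form a closed normal unipotent subgroup,
which is trivial; the kernel of B is tangent to it, hence zero.

Two tools replace the exponential map. A derivation D gives a ring homomorphism ℂ[K] → ℂ[[t]],
formally f ↦ f(exp tD). Its kernel is prime, so by the Nullstellensatz tangency to a system of
equations passes to the reduced zero set (`eval_iterate_eq_zero_of_vanishing`). Conversely,
functions vanishing at 1 together with all their derivatives vanish near 1, by an Euler field and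
Krull's intersection theorem (`exists_mul_eq_zero_of_derivation_stable`). -/

noncomputable section

/-! ### Trace forms, solvability and radicals of complex Lie algebras -/

namespace LieAlgebra

open LieModule Module

attribute [local instance] LieRing.ofAssociativeRing

section Lie

variable {L M : Type*} [LieRing L] [LieAlgebra ℂ L] [FiniteDimensional ℂ L]
  [AddCommGroup M] [Module ℂ M] [LieRingModule L M] [LieModule ℂ L M] [FiniteDimensional ℂ M]

/-- By Lie's theorem, products with a factor in `[L, rad L]` act nilpotently. -/
theorem isNilpotent_toEnd_mul_of_mem_lie_radical (d : ℕ) :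
    ∀ (M : Type*) [AddCommGroup M] [Module ℂ M] [LieRingModule L M] [LieModule ℂ L M]
      [FiniteDimensional ℂ M], finrank ℂ M = d →
      ∀ u ∈ ⁅(⊤ : LieIdeal ℂ L), radical ℂ L⁆, ∀ y : L,
        IsNilpotent (toEnd ℂ L M u * toEnd ℂ L M y) := by
  induction d using Nat.strong_induction_on with
  | _ d ih =>
  intro M _ _ _ _ _ hd u hu y
  rcases subsingleton_or_nontrivial M with hM | hM
  · exact ⟨1, LinearMap.ext fun m => Subsingleton.elim _ _⟩
  obtain ⟨χ, hχ⟩ : ∃ χ : Module.Dual ℂ (radical ℂ L), Nontrivial (weightSpace M χ) :=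
    exists_nontrivial_weightSpace_of_isSolvable ℂ (radical ℂ L) M
  -- A weight space of the ideal rad L is stable under all of L in characteristic zero.
  let N : LieSubmodule ℂ L M := weightSpaceOfIsLieTower ℂ M χ
  replace hχ : Nontrivial N := hχ
  have hN : ∀ n ∈ N, ∀ r (hr : r ∈ radical ℂ L), ⁅r, n⁆ = χ ⟨r, hr⟩ • n := by
    intro n hn r hr
    have : n ∈ weightSpace M χ := hn
    rw [mem_weightSpace] at this
    exact this ⟨r, hr⟩
  -- On N the radical acts by scalars, so a commutator with an element of it acts by zero.
  have hu0 : ∀ n ∈ N, ⁅u, n⁆ = 0 := by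
    rw [← LieSubmodule.mem_toSubmodule, LieSubmodule.lieIdeal_oper_eq_linear_span'] at hu
    induction hu using Submodule.span_induction with
    | mem x hx =>
      obtain ⟨x, -, r, hr, rfl⟩ := hx
      intro n hn
      rw [lie_lie, hN n hn r hr, hN _ (N.lie_mem hn) r hr, lie_smul, sub_self]
    | zero => simp
    | add a b _ _ ha hb => intro n hn; rw [add_lie, ha n hn, hb n hn, add_zero]
    | smul c a _ ha => intro n hn; rw [smul_lie, ha n hn, smul_zero]
  have hlt : finrank ℂ (M ⧸ N) < d := by
    have h1 := Submodule.finrank_quotient_add_finrank N.toSubmodule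
    have h2 : 0 < finrank ℂ N.toSubmodule := Module.finrank_pos_iff.2 hχ
    change finrank ℂ (M ⧸ N.toSubmodule) < d
    lia
  obtain ⟨k, hk⟩ := ih _ hlt (M ⧸ N) rfl u hu y
  -- The k-th power lands in N by induction on the quotient; in the additional factor y preserves N
  -- and u kills it.
  refine ⟨k + 1, LinearMap.ext fun m => ?_⟩
  have hcomm : ∀ j : ℕ, ∀ m : M, LieSubmodule.Quotient.mk (N := N)
      (((toEnd ℂ L M u * toEnd ℂ L M y) ^ j) m) =
      ((toEnd ℂ L (M ⧸ N) u * toEnd ℂ L (M ⧸ N) y) ^ j) (LieSubmodule.Quotient.mk m) := by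
    intro j
    induction j with
    | zero => intro m; rfl
    | succ j ihj =>
      intro m
      rw [pow_succ, pow_succ]
      exact ihj _
  have hmem : ((toEnd ℂ L M u * toEnd ℂ L M y) ^ k) m ∈ N := by
    rw [← LieSubmodule.Quotient.mk_eq_zero]
    exact (hcomm k m).trans (by rw [hk]; rfl)
  rw [pow_succ']
  exact hu0 _ (N.lie_mem hmem)

/-- `[L, rad L]` is orthogonal to `L` for every trace form. -/
theorem traceForm_eq_zero_of_mem_lie_radical {u : L}
    (hu : u ∈ ⁅(⊤ : LieIdeal ℂ L), radical ℂ L⁆) (y : L) : traceForm ℂ L M u y = 0 :=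
  (LinearMap.isNilpotent_trace_of_isNilpotent
    (isNilpotent_toEnd_mul_of_mem_lie_radical (finrank ℂ M) M rfl u hu y)).eq_zero

/-- Cartan's criterion for a faithful representation. -/
theorem isSolvable_of_traceForm_lie_eq_zero (hf : ∀ x : L, toEnd ℂ L M x = 0 → x = 0)
    (h : ∀ x y z : L, traceForm ℂ L M ⁅x, y⁆ z = 0) : IsSolvable L := by
  set D := derivedSeries ℂ L 1 with hD
  have hD' : ∀ u ∈ D, ∀ z, traceForm ℂ L M u z = 0 := by
    intro u hu z
    rw [hD, derivedSeries_def, derivedSeriesOfIdeal_succ, derivedSeriesOfIdeal_zero,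
      ← LieSubmodule.mem_toSubmodule, LieSubmodule.lieIdeal_oper_eq_linear_span'] at hu
    induction hu using Submodule.span_induction with
    | mem x hx => obtain ⟨x, -, y, -, rfl⟩ := hx; exact h x y z
    | zero => simp
    | add a b _ _ ha hb => rw [map_add, LinearMap.add_apply, ha, hb, add_zero]
    | smul c a _ ha => rw [map_smul, LinearMap.smul_apply, ha, smul_zero]
  have tf : traceForm ℂ D M = 0 := by
    ext ⟨x, hx⟩ ⟨y, hy⟩
    exact hD' x hx y
  have hn := isNilpotent_derivedSeries_of_traceForm_eq_zero tf
  rw [isNilpotent_iff_forall' (R := ℂ)] at hn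
  set DD : LieIdeal ℂ L := ⁅D, D⁆ with hDD
  -- By `hn`, each x in [D, D] acts nilpotently on M, so its commutator action on End M is
  -- nilpotent. Faithfulness pulls this back to ad x on L, and Engel's theorem applies.
  have hnil : LieRing.IsNilpotent DD := by
    rw [LieAlgebra.isNilpotent_iff_forall (R := ℂ)]
    rintro ⟨x, hx⟩
    apply LieSubalgebra.isNilpotent_ad_of_isNilpotent_ad (DD : LieSubalgebra ℂ L) (x := ⟨x, hx⟩)
    have hxn : IsNilpotent (toEnd ℂ L M x) := by
      refine hn ⟨⟨x, LieSubmodule.lie_le_left D D hx⟩, ?_⟩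
      rwa [LieIdeal.derivedSeries_eq_derivedSeriesOfIdeal_comap, LieIdeal.mem_comap]
    obtain ⟨k, hk⟩ := LieAlgebra.ad_nilpotent_of_nilpotent (R := ℂ) hxn
    refine ⟨k, LinearMap.ext fun y => hf _ ?_⟩
    have : ∀ j : ℕ, ∀ y, toEnd ℂ L M ((ad ℂ L x ^ j) y) =
        (ad ℂ (End ℂ M) (toEnd ℂ L M x) ^ j) (toEnd ℂ L M y) := by
      intro j
      induction j with
      | zero => intro y; rfl
      | succ j ihj =>
        intro y
        rw [pow_succ, pow_succ, Module.End.mul_apply, ihj, ad_apply, LieHom.map_lie]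
        rfl
    exact (this k y).trans (by rw [hk]; rfl)
  obtain ⟨k, hk⟩ := IsSolvable.solvable ℂ DD
  rw [LieIdeal.derivedSeries_eq_bot_iff] at hk
  refine IsSolvable.mk (R := ℂ) (k := k + 2) ?_
  rw [derivedSeries_def, derivedSeriesOfIdeal_add]
  convert! hk using 2

variable (L) in
/-- The quotient by the radical has trivial radical. -/
theorem hasTrivialRadical_quotient_radical : HasTrivialRadical ℂ (L ⧸ radical ℂ L) := by
  set I := radical ℂ L with hI
  let π : L →ₗ⁅ℂ⁆ L ⧸ I :=
    { (LieSubmodule.Quotient.mk' I : L →ₗ[ℂ] L ⧸ I) with map_lie' := rfl }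
  have hker : ∀ x, π x = 0 ↔ x ∈ I := fun x => LieSubmodule.Quotient.mk_eq_zero I
  refine hasTrivialRadical_of_no_solvable_ideals fun J hJ => ?_
  have hmap : ∀ k, (derivedSeriesOfIdeal ℂ L k (J.comap π)).map π ≤
      derivedSeriesOfIdeal ℂ (L ⧸ I) k J := by
    intro k
    induction k with
    | zero => exact LieIdeal.map_comap_le
    | succ k ih =>
      rw [derivedSeriesOfIdeal_succ, derivedSeriesOfIdeal_succ]
      exact (LieIdeal.map_bracket_le π).trans (LieSubmodule.mono_lie ih ih)
  obtain ⟨k, hk⟩ := IsSolvable.solvable ℂ J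
  obtain ⟨l, hl⟩ := IsSolvable.solvable ℂ I
  rw [LieIdeal.derivedSeries_eq_bot_iff] at hk hl
  -- The preimage of a solvable ideal is solvable: k derived steps bring it into the radical, and l
  -- further steps bring it to zero.
  have h1 : derivedSeriesOfIdeal ℂ L k (J.comap π) ≤ I := by
    intro x hx
    rw [← hker, ← LieSubmodule.mem_bot (R := ℂ) (L := L ⧸ I), ← hk]
    exact hmap k (LieIdeal.mem_map hx)
  have h2 : derivedSeriesOfIdeal ℂ L (l + k) (J.comap π) = ⊥ := by
    rw [derivedSeriesOfIdeal_add, eq_bot_iff, ← hl]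
    exact derivedSeriesOfIdeal_mono h1 l
  have h3 : IsSolvable (J.comap π) :=
    IsSolvable.mk (R := ℂ) ((LieIdeal.derivedSeries_eq_bot_iff _ _).2 h2)
  rw [LieIdeal.solvable_iff_le_radical] at h3
  rw [LieSubmodule.eq_bot_iff]
  intro y hy
  obtain ⟨x, rfl⟩ := LieSubmodule.Quotient.surjective_mk' I y
  exact (hker x).2 (h3 (LieIdeal.mem_comap.2 hy))

/-- Semisimple Lie algebras are perfect. -/
theorem derivedSeries_one_eq_top_of_hasTrivialRadical [HasTrivialRadical ℂ L] :
    derivedSeries ℂ L 1 = ⊤ := by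
  -- If x is orthogonal to [L, L], then κ([y, x], z) = -κ(x, [y, z]) = 0 for all y and z, so x is
  -- central and therefore zero.
  have h := LieIdeal.isCompl_killingCompl (derivedSeries ℂ L 1)
  suffices LieIdeal.killingCompl ℂ L (derivedSeries ℂ L 1) = ⊥ by
    rw [this] at h
    simpa using h.sup_eq_top
  rw [LieSubmodule.eq_bot_iff]
  intro x hx
  rw [LieIdeal.mem_killingCompl] at hx
  rw [← LieSubmodule.mem_bot (R := ℂ) (L := L), ← center_eq_bot (R := ℂ) (L := L), mem_maxTrivSubmodule]
  intro y
  have h0 := IsKilling.ker_killingForm_eq_bot ℂ L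
  rw [← Submodule.mem_bot ℂ, ← h0, LinearMap.mem_ker]
  ext z
  rw [traceForm_apply_lie_apply', LinearMap.zero_apply, neg_eq_zero, traceForm_comm]
  refine (traceForm_comm ℂ L L _ _).trans ?_
  rw [traceForm_comm]
  exact hx _ (LieSubmodule.lie_mem_lie (LieSubmodule.mem_top y) (LieSubmodule.mem_top z))

/-- A Lie algebra is generated as a vector space by its derived algebra and its radical. -/
theorem exists_derivedSeries_one_add_radical (x : L) :
    ∃ y ∈ derivedSeries ℂ L 1, ∃ r ∈ radical ℂ L, x = y + r := by
  have := hasTrivialRadical_quotient_radical L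
  have h := derivedSeries_one_eq_top_of_hasTrivialRadical (L := L ⧸ radical ℂ L)
  let π : L →ₗ⁅ℂ⁆ L ⧸ radical ℂ L :=
    { (LieSubmodule.Quotient.mk' (radical ℂ L) : L →ₗ[ℂ] L ⧸ radical ℂ L) with map_lie' := rfl }
  have hker : ∀ x, π x = 0 ↔ x ∈ radical ℂ L := fun x => LieSubmodule.Quotient.mk_eq_zero _
  have hsurj : Function.Surjective π := LieSubmodule.Quotient.surjective_mk' _
  rw [← LieIdeal.derivedSeries_map_eq 1 hsurj] at h
  have hx : π x ∈ (derivedSeries ℂ L 1).map π := h ▸ LieSubmodule.mem_top _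
  obtain ⟨⟨y, hy⟩, hyx⟩ := LieIdeal.mem_map_of_surjective hsurj hx
  refine ⟨y, hy, x - y, ?_, by abel⟩
  rw [← hker, map_sub, sub_eq_zero]
  exact hyx.symm

end Lie
end LieAlgebra

/-! ### Borel and parabolic subalgebras relative to a nondegenerate trace form -/

namespace LinAlgGrp

open LieModule Module LieAlgebra

section Parabolic

variable {L : Type*} (M : Type*) [LieRing L] [LieAlgebra ℂ L] [FiniteDimensional ℂ L]
  [AddCommGroup M] [Module ℂ M] [LieRingModule L M] [LieModule ℂ L M] [FiniteDimensional ℂ M]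

theorem traceForm_lie_eq_zero_of_mem_radical {q : LieSubalgebra ℂ L} {x y : q}
    (hx : x ∈ radical ℂ q) {w : L} (hw : w ∈ q) :
    traceForm ℂ L M ⁅(y : L), (x : L)⁆ w = 0 :=
  traceForm_eq_zero_of_mem_lie_radical (L := q) (M := M) (u := ⁅y, x⁆)
    (LieSubmodule.lie_mem_lie (LieSubmodule.mem_top y) hx) ⟨w, hw⟩

theorem traceForm_lie_eq_zero_of_isSolvable {b : LieSubalgebra ℂ L} [IsSolvable b]
    {x y z : L} (hx : x ∈ b) (hy : y ∈ b) (hz : z ∈ b) : traceForm ℂ L M ⁅x, y⁆ z = 0 :=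
  traceForm_lie_eq_zero_of_mem_radical M (q := b) (x := ⟨y, hy⟩) (y := ⟨x, hx⟩)
    (by rw [radical_eq_top_of_isSolvable]; exact LieSubmodule.mem_top _) hz

/-- A subalgebra containing a Borel subalgebra and orthogonal to its derived algebra is equal to
the Borel subalgebra. -/
theorem IsBorel.le_of_traceForm_lie_eq_zero (hB : ∀ x, (∀ y, traceForm ℂ L M x y = 0) → x = 0)
    {b p : LieSubalgebra ℂ L} (hb : IsBorel b) (hbp : b ≤ p)
    (h : ∀ x ∈ p, ∀ y ∈ p, ∀ z ∈ p, traceForm ℂ L M ⁅x, y⁆ z = 0) : p ≤ b := by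
  refine hb.2 (isSolvable_of_traceForm_lie_eq_zero (L := p) (M := M) ?_ ?_) hbp
  · rintro x hx
    refine Subtype.ext (hB x fun y => ?_)
    have : toEnd ℂ L M (x : L) = 0 := hx
    rw [traceForm_apply_apply, this, LinearMap.zero_comp, map_zero]
  · intro x y z
    exact h x x.2 y y.2 z z.2

/-- A Borel subalgebra contains the radical of every larger subalgebra. -/
theorem IsBorel.radical_mem (hB : ∀ x, (∀ y, traceForm ℂ L M x y = 0) → x = 0)
    {b q : LieSubalgebra ℂ L} (hb : IsBorel b) (hbq : b ≤ q) {r : q} (hr : r ∈ radical ℂ q) :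
    (r : L) ∈ b := by
  have := hb.1
  let R : Submodule ℂ L := (radical ℂ q).toSubmodule.map q.toSubmodule.subtype
  have hRq : ∀ x ∈ R, x ∈ q := by
    rintro _ ⟨x, -, rfl⟩
    exact x.2
  have hR : ∀ y ∈ q, ∀ x ∈ R, ⁅y, x⁆ ∈ R := by
    rintro y hy _ ⟨x, hx, rfl⟩
    exact ⟨⁅(⟨y, hy⟩ : q), x⁆, (radical ℂ q).lie_mem hx, rfl⟩
  have hR0 : ∀ y ∈ q, ∀ x ∈ R, ∀ w ∈ q, traceForm ℂ L M ⁅y, x⁆ w = 0 := by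
    rintro y hy _ ⟨x, hx, rfl⟩ w hw
    exact traceForm_lie_eq_zero_of_mem_radical M (y := ⟨y, hy⟩) hx hw
  have hskew : ∀ y ∈ q, ∀ x ∈ R, ⁅x, y⁆ ∈ R := by
    intro y hy x hx
    rw [← lie_skew]
    exact neg_mem (hR y hy x hx)
  have hskew0 : ∀ y ∈ q, ∀ x ∈ R, ∀ w ∈ q, traceForm ℂ L M ⁅x, y⁆ w = 0 := by
    intro y hy x hx w hw
    rw [← lie_skew, map_neg, LinearMap.neg_apply, hR0 y hy x hx w hw, neg_zero]
  -- The sum b + rad q is a subalgebra orthogonal to its derived algebra, so Cartan's criterion and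
  -- the maximality of b give b + rad q = b.
  let p : LieSubalgebra ℂ L :=
    { b.toSubmodule ⊔ R with
      lie_mem' := by
        intro x y hx hy
        change x ∈ b.toSubmodule ⊔ R at hx
        change y ∈ b.toSubmodule ⊔ R at hy
        obtain ⟨h, hh, x, hxR, rfl⟩ := Submodule.mem_sup.1 hx
        obtain ⟨k, hk, y, hyR, rfl⟩ := Submodule.mem_sup.1 hy
        change _ ∈ b.toSubmodule ⊔ R
        rw [add_lie, lie_add, lie_add, add_assoc]
        exact Submodule.add_mem_sup (b.lie_mem hh hk) (add_mem (hR _ (hbq hh) _ hyR)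
          (add_mem (hskew _ (hbq hk) _ hxR) (hR _ (hRq _ hxR) _ hyR))) }
  have hp : p ≤ b := by
    refine hb.le_of_traceForm_lie_eq_zero M hB
      (fun x hx => Submodule.mem_sup_left (S := b.toSubmodule) hx) ?_
    intro x hx y hy z hz
    obtain ⟨h, hh, x, hxR, rfl⟩ := Submodule.mem_sup.1 (show x ∈ b.toSubmodule ⊔ R from hx)
    obtain ⟨k, hk, y, hyR, rfl⟩ := Submodule.mem_sup.1 (show y ∈ b.toSubmodule ⊔ R from hy)
    obtain ⟨l, hl, z, hzR, rfl⟩ := Submodule.mem_sup.1 (show z ∈ b.toSubmodule ⊔ R from hz)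
    have hlz : l + z ∈ q := add_mem (hbq hl) (hRq _ hzR)
    -- By invariance the mixed term is B(h, [k, z]), and [k, z] lies in [q, rad q], which is
    -- orthogonal to q.
    have e1 : traceForm ℂ L M ⁅h, k⁆ (l + z) = 0 := by
      rw [map_add, traceForm_lie_eq_zero_of_isSolvable M hh hk hl, traceForm_apply_lie_apply,
        traceForm_comm, hR0 _ (hbq hk) _ hzR _ (hbq hh), add_zero]
    rw [add_lie, lie_add, lie_add]
    simp only [map_add (traceForm ℂ L M), LinearMap.add_apply]
    rw [e1, hR0 _ (hbq hh) _ hyR _ hlz, hskew0 _ (hbq hk) _ hxR _ hlz, hR0 _ (hRq _ hxR) _ hyR _ hlz]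
    simp
  exact hp (Submodule.mem_sup_right (S := b.toSubmodule) (T := R) ⟨r, hr, rfl⟩)

/-- A Borel subalgebra contains its orthogonal complement. -/
theorem IsBorel.mem_of_orthogonal (hB : ∀ x, (∀ y, traceForm ℂ L M x y = 0) → x = 0)
    {b : LieSubalgebra ℂ L} (hb : IsBorel b) {z : L}
    (hz : ∀ y ∈ b, traceForm ℂ L M z y = 0) : z ∈ b := by
  have := hb.1
  by_contra hzb
  -- If b^⊥ were not inside b, Lie's theorem applied to the image of b^⊥ in L/b would give x in b^⊥,
  -- outside b, with [h, x] ∈ χ(h)x + b for all h in b.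
  let N : LieSubmodule ℂ b L :=
    { carrier := {x | ∀ y ∈ b, traceForm ℂ L M x y = 0}
      add_mem' := fun {x x'} hx hx' y hy => by
        rw [map_add, LinearMap.add_apply, hx y hy, hx' y hy, add_zero]
      zero_mem' := fun y _ => by simp
      smul_mem' := fun c x hx y hy => by rw [map_smul, LinearMap.smul_apply, hx y hy, smul_zero]
      lie_mem := fun {h x} hx y hy => by
        change traceForm ℂ L M ⁅(h : L), x⁆ y = 0
        rw [traceForm_apply_lie_apply', hx _ (b.lie_mem h.2 hy), neg_zero] }
  let Q := L ⧸ b.toLieSubmodule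
  let V : LieSubmodule ℂ b Q := N.map (LieSubmodule.Quotient.mk' b.toLieSubmodule)
  have hV : Nontrivial V := by
    refine nontrivial_of_ne ⟨LieSubmodule.Quotient.mk' b.toLieSubmodule z,
      LieSubmodule.mem_map_of_mem hz⟩ 0 fun h => hzb ?_
    exact (LieSubmodule.Quotient.mk_eq_zero b.toLieSubmodule).1 (congrArg Subtype.val h)
  obtain ⟨χ, hχ⟩ := exists_nontrivial_weightSpace_of_isSolvable ℂ b V
  obtain ⟨⟨⟨v, hvV⟩, hv⟩, hv0⟩ := exists_ne (0 : weightSpace V χ)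
  rw [mem_weightSpace] at hv
  obtain ⟨x, hxN, rfl⟩ := (LieSubmodule.mem_map _).1 hvV
  have hxN' : ∀ y ∈ b, traceForm ℂ L M x y = 0 := hxN
  have hxb : x ∉ b := by
    intro hx
    apply hv0
    apply Subtype.ext
    apply Subtype.ext
    exact (LieSubmodule.Quotient.mk_eq_zero b.toLieSubmodule).2 hx
  have hx : ∀ h (hh : h ∈ b), ⁅h, x⁆ - χ ⟨h, hh⟩ • x ∈ b := by
    intro h hh
    have e := congrArg Subtype.val (hv ⟨h, hh⟩)
    refine (LieSubmodule.Quotient.mk_eq_zero b.toLieSubmodule).1 ?_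
    rw [map_sub, map_smul, sub_eq_zero]
    exact e
  -- Then b + ℂx is again a subalgebra orthogonal to its derived algebra, the critical term being
  -- B([h, x], x) = B(h, [x, x]) = 0. This contradicts the maximality of b.
  let p : LieSubalgebra ℂ L :=
    { b.toSubmodule ⊔ Submodule.span ℂ {x} with
      lie_mem' := by
        intro y y' hy hy'
        change y ∈ b.toSubmodule ⊔ _ at hy
        change y' ∈ b.toSubmodule ⊔ _ at hy'
        obtain ⟨h, hh, _, hc, rfl⟩ := Submodule.mem_sup.1 hy
        obtain ⟨k, hk, _, hd, rfl⟩ := Submodule.mem_sup.1 hy'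
        obtain ⟨c, rfl⟩ := Submodule.mem_span_singleton.1 hc
        obtain ⟨d, rfl⟩ := Submodule.mem_span_singleton.1 hd
        change _ ∈ b.toSubmodule ⊔ _
        have e : ⁅h + c • x, k + d • x⁆ = (⁅h, k⁆ + d • (⁅h, x⁆ - χ ⟨h, hh⟩ • x)
            - c • (⁅k, x⁆ - χ ⟨k, hk⟩ • x)) + (d * χ ⟨h, hh⟩ - c * χ ⟨k, hk⟩) • x := by
          rw [add_lie, lie_add, lie_add, smul_lie, smul_lie, lie_smul, lie_smul, lie_self,
            ← lie_skew x k]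
          module
        rw [e]
        exact Submodule.add_mem_sup (sub_mem (add_mem (b.lie_mem hh hk)
          (b.smul_mem _ (hx h hh))) (b.smul_mem _ (hx k hk)))
          (Submodule.smul_mem _ _ (Submodule.mem_span_singleton_self x)) }
  have hp : p ≤ b := by
    refine hb.le_of_traceForm_lie_eq_zero M hB
      (fun x hx => Submodule.mem_sup_left (S := b.toSubmodule) hx) ?_
    intro y hy y' hy' w hw
    obtain ⟨h, hh, _, hc, rfl⟩ := Submodule.mem_sup.1 (show y ∈ b.toSubmodule ⊔ _ from hy)
    obtain ⟨k, hk, _, hd, rfl⟩ := Submodule.mem_sup.1 (show y' ∈ b.toSubmodule ⊔ _ from hy')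
    obtain ⟨l, hl, _, hf, rfl⟩ := Submodule.mem_sup.1 (show w ∈ b.toSubmodule ⊔ _ from hw)
    obtain ⟨c, rfl⟩ := Submodule.mem_span_singleton.1 hc
    obtain ⟨d, rfl⟩ := Submodule.mem_span_singleton.1 hd
    obtain ⟨f, rfl⟩ := Submodule.mem_span_singleton.1 hf
    have e1 : ∀ h ∈ b, traceForm ℂ L M ⁅h, x⁆ (l + f • x) = 0 := by
      intro h hh
      rw [map_add, map_smul, traceForm_apply_lie_apply', hxN' _ (b.lie_mem hh hl),
        traceForm_apply_lie_apply, lie_self]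
      simp
    have e2 : traceForm ℂ L M ⁅h, k⁆ (l + f • x) = 0 := by
      rw [map_add, map_smul, traceForm_lie_eq_zero_of_isSolvable M hh hk hl, traceForm_comm,
        hxN' _ (b.lie_mem hh hk)]
      simp
    rw [add_lie, lie_add, lie_add, smul_lie, smul_lie, lie_smul, lie_smul, lie_self,
      ← lie_skew x k]
    simp only [map_add (traceForm ℂ L M), map_smul (traceForm ℂ L M), map_neg (traceForm ℂ L M),
      LinearMap.add_apply, LinearMap.smul_apply, LinearMap.neg_apply]
    rw [e2, e1 _ hh, e1 _ hk]
    simp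
  exact hxb (hp (Submodule.mem_sup_right (S := b.toSubmodule)
    (Submodule.mem_span_singleton_self x)))

/-- The orthogonal complement of a parabolic subalgebra is contained in its nilpotent radical. -/
theorem IsParabolic.mem_nilpotentRadical_of_orthogonal
    (hB : ∀ x, (∀ y, traceForm ℂ L M x y = 0) → x = 0)
    {q : LieSubalgebra ℂ L} (hq : IsParabolic q) {z : L}
    (hz : ∀ y ∈ q, traceForm ℂ L M z y = 0) :
    z ∈ (nilpotentRadical q).toSubmodule.map q.toSubmodule.subtype := by
  obtain ⟨b, hb, hbq⟩ := hq
  have := hb.1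
  have horthb : ∀ x, (∀ y ∈ q, traceForm ℂ L M x y = 0) → x ∈ b := fun x hx =>
    hb.mem_of_orthogonal M hB fun y hy => hx y (hbq hy)
  -- q^⊥ is an ideal of q, and it is solvable because it lies in b; hence q^⊥ ⊆ rad q.
  let J : LieIdeal ℂ q :=
    { carrier := {x | ∀ y ∈ q, traceForm ℂ L M (x : L) y = 0}
      add_mem' := fun {x x'} hx hx' y hy => by
        change traceForm ℂ L M ((x : L) + x') y = 0
        rw [map_add, LinearMap.add_apply, hx y hy, hx' y hy, add_zero]
      zero_mem' := fun y _ => by simp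
      smul_mem' := fun c x hx y hy => by
        change traceForm ℂ L M (c • (x : L)) y = 0
        rw [map_smul, LinearMap.smul_apply, hx y hy, smul_zero]
      lie_mem := fun {h x} hx y hy => by
        change traceForm ℂ L M ⁅(h : L), (x : L)⁆ y = 0
        rw [traceForm_apply_lie_apply', hx _ (q.lie_mem h.2 hy), neg_zero] }
  have hJ : J ≤ radical ℂ q := by
    rw [← LieIdeal.solvable_iff_le_radical]
    let f : J →ₗ⁅ℂ⁆ b :=
      { toFun := fun x => ⟨x, horthb x x.2⟩
        map_add' := fun _ _ => rfl
        map_smul' := fun _ _ => rfl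
        map_lie' := rfl }
    refine Function.Injective.lieAlgebra_isSolvable (f := f) fun x y h => ?_
    exact Subtype.ext (Subtype.ext (congrArg (fun w : b => (w : L)) h))
  have horth : ∀ x, (∀ y ∈ q, traceForm ℂ L M x y = 0) →
      ∃ h : x ∈ q, (⟨x, h⟩ : q) ∈ radical ℂ q := fun x hx => ⟨hbq (horthb x hx), hJ hx⟩
  -- This is the orthogonal complement of [q, rad q], written as the set of y with [y, rad q] ⊆ q^⊥.
  -- It is closed under brackets because q^⊥ ⊆ rad q. For the same reason rad q is a solvable ideal
  -- of it.
  let q' : LieSubalgebra ℂ L :=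
    { carrier := {y | ∀ r ∈ radical ℂ q, ∀ w ∈ q, traceForm ℂ L M ⁅y, (r : L)⁆ w = 0}
      add_mem' := fun {x x'} hx hx' r hr w hw => by
        rw [add_lie, map_add, LinearMap.add_apply, hx r hr w hw, hx' r hr w hw, add_zero]
      zero_mem' := fun r _ w _ => by simp
      smul_mem' := fun c x hx r hr w hw => by
        rw [smul_lie, map_smul, LinearMap.smul_apply, hx r hr w hw, smul_zero]
      lie_mem' := fun {x x'} hx hx' r hr w hw => by
        obtain ⟨h1, h2⟩ := horth _ (hx r hr)
        obtain ⟨h1', h2'⟩ := horth _ (hx' r hr)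
        rw [lie_lie, map_sub, LinearMap.sub_apply, hx _ h2' w hw, hx' _ h2 w hw, sub_zero] }
  have hqq' : q ≤ q' := fun y hy r hr w hw =>
    traceForm_lie_eq_zero_of_mem_radical M (y := ⟨y, hy⟩) hr hw
  let R : LieIdeal ℂ q' :=
    { carrier := {x | ∃ h : (x : L) ∈ q, (⟨x, h⟩ : q) ∈ radical ℂ q}
      add_mem' := fun {x x'} ⟨h, hx⟩ ⟨h', hx'⟩ => ⟨add_mem h h', add_mem hx hx'⟩
      zero_mem' := ⟨zero_mem q, zero_mem (radical ℂ q)⟩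
      smul_mem' := fun c x ⟨h, hx⟩ => ⟨q.smul_mem c h, (radical ℂ q).smul_mem c hx⟩
      lie_mem := fun {y x} ⟨h, hx⟩ => horth _ fun w hw => y.2 _ hx w hw }
  have hR : R ≤ radical ℂ q' := by
    rw [← LieIdeal.solvable_iff_le_radical]
    let f : R →ₗ⁅ℂ⁆ radical ℂ q :=
      { toFun := fun x => ⟨⟨x, x.2.1⟩, x.2.2⟩
        map_add' := fun _ _ => rfl
        map_smul' := fun _ _ => rfl
        map_lie' := rfl }
    refine Function.Injective.lieAlgebra_isSolvable (f := f) fun x y h => ?_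
    exact Subtype.ext (Subtype.ext (congrArg (fun w : radical ℂ q => ((w : q) : L)) h))
  set m : Submodule ℂ L := (nilpotentRadical q).toSubmodule.map q.toSubmodule.subtype with hm
  have hnd : (traceForm ℂ L M).Nondegenerate := by
    exact (traceForm_isSymm ℂ L M).isRefl.nondegenerate_iff_separatingLeft.2 hB
  -- By double orthogonality, it suffices that z is orthogonal to every y in m^⊥ ⊆ `q'`.
  rw [← LinearMap.BilinForm.orthogonal_orthogonal hnd (traceForm_isSymm ℂ L M).isRefl m]
  intro y hy
  have hym : ∀ u ∈ m, traceForm ℂ L M u y = 0 := hy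
  change traceForm ℂ L M y z = 0
  rw [traceForm_comm]
  have hyq' : y ∈ q' := by
    intro r hr w hw
    rw [traceForm_apply_lie_apply, traceForm_comm, ← lie_skew, map_neg, LinearMap.neg_apply,
      neg_eq_zero]
    refine hym _ ⟨⁅(⟨w, hw⟩ : q), r⁆, ?_, rfl⟩
    exact LieSubmodule.lie_mem_lie (LieSubmodule.mem_top _) hr
  -- The radical part r lies in b ⊆ q, so z is orthogonal to it. For d = [x, w], invariance moves
  -- the bracket onto z, which lies in rad `q'`, and [`q'`, rad `q'`] is orthogonal to `q'`.
  obtain ⟨d, hd, r, hr, hyd⟩ := exists_derivedSeries_one_add_radical (⟨y, hyq'⟩ : q')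
  have hyd' : y = (d : L) + r := congrArg Subtype.val hyd
  obtain ⟨hzq, hzr⟩ := horth z hz
  have hzq' : z ∈ q' := hqq' hzq
  have hzR : (⟨z, hzq'⟩ : q') ∈ radical ℂ q' := hR ⟨hzq, hzr⟩
  rw [hyd', map_add, hz _ (hbq (hb.radical_mem M hB (hbq.trans hqq') hr)), add_zero]
  rw [derivedSeries_def, derivedSeriesOfIdeal_succ, derivedSeriesOfIdeal_zero,
    ← LieSubmodule.mem_toSubmodule, LieSubmodule.lieIdeal_oper_eq_linear_span'] at hd
  clear hyd hyd'
  induction hd using Submodule.span_induction with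
  | mem x hx =>
    obtain ⟨x, -, w, -, rfl⟩ := hx
    change traceForm ℂ L M z ⁅(x : L), (w : L)⁆ = 0
    rw [← traceForm_apply_lie_apply, ← lie_skew, map_neg, LinearMap.neg_apply,
      traceForm_lie_eq_zero_of_mem_radical M (x := ⟨z, hzq'⟩) (y := x) hzR w.2, neg_zero]
  | zero => simp
  | add a b _ _ ha hb =>
    change traceForm ℂ L M z ((a : L) + b) = 0
    rw [map_add, ha, hb, add_zero]
  | smul c a _ ha =>
    change traceForm ℂ L M z (c • (a : L)) = 0
    rw [map_smul, ha, smul_zero]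

end Parabolic
end LinAlgGrp

/-! ### The coordinate ring: points, Nullstellensatz and formal exponentials -/

namespace LinAlgGrp

variable {n : ℕ} {K : Subgroup (GL (Fin n) ℂ)}

/-- Evaluation at a point as a homomorphism on the coordinate ring. -/
def evalHom (x : K) : coordRing K →ₐ[ℂ] ℂ where
  toFun f := (f : K → ℂ) x
  map_one' := rfl
  map_mul' _ _ := rfl
  map_zero' := rfl
  map_add' _ _ := rfl
  commutes' _ := rfl

instance finiteType_coordRing : Algebra.FiniteType ℂ (coordRing K) := by
  rw [← Subalgebra.fg_iff_finiteType]
  have hfin : ({f | ∃ i j, f = entry K i j} ∪ {f | ∃ i j, f = invEntry K i j} :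
      Set (K → ℂ)).Finite := by
    refine Set.Finite.union ?_ ?_
    · refine (Set.finite_range fun ij : Fin n × Fin n => entry K ij.1 ij.2).subset ?_
      rintro _ ⟨i, j, rfl⟩
      exact ⟨(i, j), rfl⟩
    · refine (Set.finite_range fun ij : Fin n × Fin n => invEntry K ij.1 ij.2).subset ?_
      rintro _ ⟨i, j, rfl⟩
      exact ⟨(i, j), rfl⟩
  exact ⟨hfin.toFinset, by rw [hfin.coe_toFinset]; rfl⟩

/-- Every homomorphism `ℂ[K] → ℂ` is the evaluation at a point of `K`. -/
theorem exists_eq_evalHom (hK : IsZariskiClosed (K : Set (GL (Fin n) ℂ)))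
    (ψ : coordRing K →ₐ[ℂ] ℂ) : ∃ x : K, ψ = evalHom x := by
  obtain ⟨I, hI⟩ := hK
  let e : Fin n × Fin n → coordRing K := fun ij => ⟨entry K ij.1 ij.2, entry_mem ij.1 ij.2⟩
  let e' : Fin n × Fin n → coordRing K :=
    fun ij => ⟨invEntry K ij.1 ij.2, invEntry_mem ij.1 ij.2⟩
  have h1 : ∀ i j, ∑ k, e (i, k) * e' (k, j) = if i = j then 1 else 0 := by
    intro i j
    apply Subtype.ext
    funext x
    have : (((x : GL (Fin n) ℂ) : Matrix (Fin n) (Fin n) ℂ) *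
        (((x⁻¹ : K) : GL (Fin n) ℂ) : Matrix (Fin n) (Fin n) ℂ)) i j =
        (1 : Matrix (Fin n) (Fin n) ℂ) i j := by
      rw [← Units.val_mul, ← Subgroup.coe_mul, mul_inv_cancel]; rfl
    rw [Matrix.mul_apply, Matrix.one_apply] at this
    simp only [AddSubmonoidClass.coe_finsetSum, Finset.sum_apply]
    refine this.trans ?_
    split_ifs <;> rfl
  let g : Matrix (Fin n) (Fin n) ℂ := Matrix.of fun i j => ψ (e (i, j))
  let g' : Matrix (Fin n) (Fin n) ℂ := Matrix.of fun i j => ψ (e' (i, j))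
  -- The generators include the entries of x⁻¹ so that the images under ψ form an invertible matrix.
  have hgg' : g * g' = 1 := by
    ext i j
    rw [Matrix.mul_apply, Matrix.one_apply]
    have := congrArg ψ (h1 i j)
    rw [map_sum] at this
    simp only [map_mul] at this
    refine this.trans ?_
    split_ifs <;> simp
  let u : GL (Fin n) ℂ := ⟨g, g', hgg', mul_eq_one_comm.1 hgg'⟩
  have hu : u ∈ K := by
    rw [← SetLike.mem_coe, hI]
    intro p hp
    have h2 : MvPolynomial.aeval e p = 0 := by
      apply Subtype.ext
      funext x
      have hx : (x : GL (Fin n) ℂ) ∈ (K : Set (GL (Fin n) ℂ)) := x.2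
      rw [hI] at hx
      have := MvPolynomial.comp_aeval_apply (φ := evalHom x) e p
      refine this.trans ?_
      exact hx p hp
    have := MvPolynomial.comp_aeval_apply (φ := ψ) e p
    rw [h2, map_zero] at this
    exact this.symm
  refine ⟨⟨u, hu⟩, ?_⟩
  have key : ∀ (f : K → ℂ) (hf : f ∈ coordRing K), ψ ⟨f, hf⟩ = f ⟨u, hu⟩ := by
    intro f hf
    induction hf using Algebra.adjoin_induction with
    | mem f hf =>
      rcases hf with ⟨i, j, rfl⟩ | ⟨i, j, rfl⟩
      · rfl
      · rfl
    | algebraMap r => exact ψ.commutes r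
    | add f g hf hg ihf ihg =>
      rw [Pi.add_apply, ← ihf, ← ihg, ← map_add]
      rfl
    | mul f g hf hg ihf ihg =>
      rw [Pi.mul_apply, ← ihf, ← ihg, ← map_mul]
      rfl
  ext ⟨f, hf⟩
  exact key f hf

/-- Residue fields of finitely generated complex algebras are equal to `ℂ`. -/
theorem exists_algHom_ker_eq {A : Type*} [CommRing A] [Algebra ℂ A] [Algebra.FiniteType ℂ A]
    (m : Ideal A) [hm : m.IsMaximal] : ∃ ψ : A →ₐ[ℂ] ℂ, ∀ f, f ∈ m ↔ ψ f = 0 := by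
  let _ := Ideal.Quotient.field m
  have : Module.Finite ℂ (A ⧸ m) := finite_of_finite_type_of_isJacobsonRing ℂ _
  have hb : Function.Bijective (algebraMap ℂ (A ⧸ m)) :=
    IsAlgClosed.algebraMap_bijective_of_isIntegral
  let ι : ℂ ≃ₐ[ℂ] A ⧸ m := AlgEquiv.ofBijective (Algebra.ofId _ _) hb
  refine ⟨ι.symm.toAlgHom.comp (Ideal.Quotient.mkₐ ℂ m), fun f => ?_⟩
  change _ ↔ ι.symm (Ideal.Quotient.mk m f) = 0
  rw [EmbeddingLike.map_eq_zero_iff, Ideal.Quotient.eq_zero_iff_mem]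

/-- The Nullstellensatz for `ℂ[K]`. -/
theorem mem_radical_of_forall_eq_zero (hK : IsZariskiClosed (K : Set (GL (Fin n) ℂ)))
    (J : Ideal (coordRing K)) (h : coordRing K)
    (hh : ∀ x : K, (∀ f ∈ J, (f : K → ℂ) x = 0) → (h : K → ℂ) x = 0) : h ∈ J.radical := by
  have : IsJacobsonRing (coordRing K) := isJacobsonRing_of_finiteType (A := ℂ)
  rw [Ideal.radical_eq_jacobson, Ideal.jacobson, Submodule.mem_sInf]
  rintro m ⟨hJm, hm⟩
  obtain ⟨ψ, hψ⟩ := exists_algHom_ker_eq m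
  obtain ⟨x, rfl⟩ := exists_eq_evalHom hK ψ
  exact (hψ h).2 (hh x fun f hf => (hψ f).1 (hJm hf))

section FormalExp

variable {A : Type*} [CommRing A] [Algebra ℂ A]

/-- The formal one-parameter family `f ↦ ∑ ε(Dⁿ f) tⁿ / n!`. -/
def formalExpFun (D : Derivation ℂ A A) (ε : A →ₐ[ℂ] ℂ) (f : A) : PowerSeries ℂ :=
  PowerSeries.mk fun k => ε (D^[k] f) / (k.factorial : ℂ)

/-- This is the differential equation of the flow; it lets identities between formal exponentials be
proved coefficient by coefficient. -/
theorem derivative_formalExpFun (D : Derivation ℂ A A) (ε : A →ₐ[ℂ] ℂ) (f : A) :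
    PowerSeries.derivative ℂ (formalExpFun D ε f) = formalExpFun D ε (D f) := by
  ext k
  rw [PowerSeries.coeff_derivative, formalExpFun, formalExpFun,
    PowerSeries.coeff_mk, PowerSeries.coeff_mk, Nat.factorial_succ, Function.iterate_succ_apply]
  have : (k.factorial : ℂ) ≠ 0 := by exact_mod_cast k.factorial_ne_zero
  have : (k + 1 : ℂ) ≠ 0 := by exact_mod_cast k.succ_ne_zero
  push_cast
  field_simp

theorem formalExpFun_add (D : Derivation ℂ A A) (ε : A →ₐ[ℂ] ℂ) (f g : A) :
    formalExpFun D ε (f + g) = formalExpFun D ε f + formalExpFun D ε g := by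
  ext k
  simp only [formalExpFun, map_add, PowerSeries.coeff_mk, ← add_div]
  rw [← map_add, iterate_map_add]

/-- Both sides have the same constant term and satisfy the same differential equation, so the
iterated Leibniz formula is not needed. -/
theorem formalExpFun_mul (D : Derivation ℂ A A) (ε : A →ₐ[ℂ] ℂ) (f g : A) :
    formalExpFun D ε (f * g) = formalExpFun D ε f * formalExpFun D ε g := by
  ext k
  induction k generalizing f g with
  | zero => simp [formalExpFun]
  | succ k ih =>
    have hk : (k + 1 : ℂ) ≠ 0 := by exact_mod_cast k.succ_ne_zero
    have h : ∀ F : PowerSeries ℂ, PowerSeries.coeff (k + 1) F * (k + 1 : ℂ) =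
        PowerSeries.coeff k (PowerSeries.derivative ℂ F) := fun F => by
      rw [PowerSeries.coeff_derivative]
    refine mul_right_cancel₀ hk ?_
    rw [h, h, derivative_formalExpFun, Derivation.leibniz, Derivation.leibniz, smul_eq_mul,
      smul_eq_mul, smul_eq_mul, smul_eq_mul, formalExpFun_add, map_add, map_add, ih, ih,
      derivative_formalExpFun, derivative_formalExpFun]

/-- The formal exponential of a derivation as a ring homomorphism. -/
def formalExp (D : Derivation ℂ A A) (ε : A →ₐ[ℂ] ℂ) : A →+* PowerSeries ℂ where
  toFun := formalExpFun D ε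
  map_one' := by
    ext k
    rcases k with _ | k
    · simp [formalExpFun]
    · have : D^[k] (0 : A) = 0 := iterate_map_zero D k
      simp [formalExpFun, PowerSeries.coeff_one, this]
  map_mul' := formalExpFun_mul D ε
  map_zero' := by
    ext k
    simp [formalExpFun]
  map_add' := formalExpFun_add D ε

theorem formalExp_eq_zero_iff (D : Derivation ℂ A A) (ε : A →ₐ[ℂ] ℂ) (f : A) :
    formalExp D ε f = 0 ↔ ∀ k, ε (D^[k] f) = 0 := by
  rw [PowerSeries.ext_iff]
  refine forall_congr' fun k => ?_
  have : (k.factorial : ℂ) ≠ 0 := by exact_mod_cast k.factorial_ne_zero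
  simp [formalExp, formalExpFun, this]

end FormalExp

/-- If a derivation of `ℂ[K]` is tangent to the scheme defined by `J` to infinite order at `1`,
then it is tangent to its reduction, locally around `1`. -/
theorem eval_iterate_eq_zero_of_vanishing (hK : IsZariskiClosed (K : Set (GL (Fin n) ℂ)))
    (D : Derivation ℂ (coordRing K) (coordRing K)) (J : Set (coordRing K))
    (hJ : ∀ f ∈ J, ∀ k, (D^[k] f : K → ℂ) 1 = 0) (g h : coordRing K)
    (hg : (g : K → ℂ) 1 ≠ 0)
    (hh : ∀ x : K, (∀ f ∈ J, (f : K → ℂ) x = 0) → (g : K → ℂ) x ≠ 0 → (h : K → ℂ) x = 0)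
    (k : ℕ) : (D^[k] h : K → ℂ) 1 = 0 := by
  have hmem : g * h ∈ (Ideal.span J).radical := by
    refine mem_radical_of_forall_eq_zero hK _ _ fun x hx => ?_
    by_cases hgx : (g : K → ℂ) x = 0
    · exact mul_eq_zero_of_left hgx _
    · exact mul_eq_zero_of_right _ (hh x (fun f hf => hx f (Ideal.subset_span hf)) hgx)
  obtain ⟨N, hN⟩ := hmem
  -- The power series ring is a domain, so the kernel also contains gh. The series of g has nonzero
  -- constant term, which leaves h in the kernel.
  have hle : Ideal.span J ≤ RingHom.ker (formalExp D (evalHom 1)) := by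
    rw [Ideal.span_le]
    intro f hf
    exact (formalExp_eq_zero_iff _ _ _).2 (hJ f hf)
  have h0 := hle hN
  rw [RingHom.mem_ker, map_pow, map_mul] at h0
  rcases mul_eq_zero.1 (eq_zero_of_pow_eq_zero h0) with h1 | h1
  · exact absurd ((formalExp_eq_zero_iff _ _ _).1 h1 0) hg
  · exact (formalExp_eq_zero_iff _ _ _).1 h1 k

end LinAlgGrp

/-! ### Differentials of representations and the matrix form of the Lie algebra -/

namespace LinAlgGrp

open Module

attribute [local instance] LieRing.ofAssociativeRing

variable {n : ℕ} {K : Subgroup (GL (Fin n) ℂ)}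

theorem lieAlg_apply_eq (D : lieAlg K) (f : coordRing K) (x : K) :
    ((D : Derivation ℂ (coordRing K) (coordRing K)) f : K → ℂ) x =
      ((D : Derivation ℂ (coordRing K) (coordRing K))
        (pullback (fun y => x * y) (isRegularMap_mul_left x) f) : K → ℂ) 1 := by
  rw [D.2 x f, pullback_apply, mul_one]

section Rep

variable {F : Type*} [AddCommGroup F] [Module ℂ F] {ρ : Representation ℂ K F}

/-- Matrix coefficients of an algebraic representation. -/
def matrixCoeff (hρ : IsAlgebraicRep ρ) (l : Dual ℂ F) (v : F) : coordRing K :=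
  ⟨fun x => l (ρ x v), hρ l v⟩

theorem matrixCoeff_apply (hρ : IsAlgebraicRep ρ) (l : Dual ℂ F) (v : F) (x : K) :
    (matrixCoeff hρ l v : K → ℂ) x = l (ρ x v) := rfl

/-- Matrix coefficients as a bilinear map. -/
def matrixCoeffHom (hρ : IsAlgebraicRep ρ) : Dual ℂ F →ₗ[ℂ] F →ₗ[ℂ] coordRing K :=
  LinearMap.mk₂ ℂ (matrixCoeff hρ) (fun _ _ _ => rfl) (fun _ _ _ => rfl)
    (fun l v w => by apply Subtype.ext; funext x; simp [matrixCoeff_apply])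
    (fun c l v => by apply Subtype.ext; funext x; simp [matrixCoeff_apply])

theorem matrixCoeffHom_apply (hρ : IsAlgebraicRep ρ) (l : Dual ℂ F) (v : F) :
    matrixCoeffHom hρ l v = matrixCoeff hρ l v := rfl

variable [FiniteDimensional ℂ F]

/-- The differential of an algebraic representation as a linear endomorphism. -/
def repDeriv (hρ : IsAlgebraicRep ρ) (D : Derivation ℂ (coordRing K) (coordRing K)) : End ℂ F :=
  ∑ i, LinearMap.smulRight (((evalHom (1 : K)).toLinearMap ∘ₗ D.toLinearMap) ∘ₗ
    matrixCoeffHom hρ ((finBasis ℂ F).coord i)) (finBasis ℂ F i)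

theorem dual_repDeriv (hρ : IsAlgebraicRep ρ) (D : Derivation ℂ (coordRing K) (coordRing K))
    (l : Dual ℂ F) (v : F) :
    l (repDeriv hρ D v) = (D (matrixCoeff hρ l v) : K → ℂ) 1 := by
  have hl : l = ∑ i, l (finBasis ℂ F i) • (finBasis ℂ F).coord i := by
    refine (finBasis ℂ F).ext fun j => ?_
    simp
  let ψ : Dual ℂ F →ₗ[ℂ] ℂ :=
    ((evalHom (1 : K)).toLinearMap ∘ₗ D.toLinearMap) ∘ₗ (matrixCoeffHom hρ).flip v
  have h1 : l (repDeriv hρ D v) = ∑ i, ψ ((finBasis ℂ F).coord i) * l (finBasis ℂ F i) := by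
    simp only [repDeriv, LinearMap.sum_apply, LinearMap.smulRight_apply, map_sum, map_smul,
      smul_eq_mul]
    rfl
  rw [h1]
  change _ = ψ l
  conv_rhs => rw [hl, map_sum]
  exact Finset.sum_congr rfl fun i _ => by rw [map_smul, smul_eq_mul, mul_comm]

theorem eq_of_forall_dual {u v : F} (h : ∀ l : Dual ℂ F, l u = l v) : u = v := by
  rw [← sub_eq_zero, ← Module.forall_dual_apply_eq_zero_iff ℂ]
  intro l
  rw [map_sub, h, sub_self]

/-- Left invariance moves the evaluation from x to 1, and the translate of a coefficient is the
coefficient of l ∘ ρ(x). Tangency conditions on coefficients thereby become statements about powers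
of the differential of ρ. -/
theorem lieAlg_matrixCoeff (hρ : IsAlgebraicRep ρ) (D : lieAlg K) (l : Dual ℂ F) (v : F) :
    (D : Derivation ℂ (coordRing K) (coordRing K)) (matrixCoeff hρ l v) =
      matrixCoeff hρ l (repDeriv hρ D v) := by
  apply Subtype.ext
  funext x
  rw [lieAlg_apply_eq, matrixCoeff_apply]
  have h : pullback (fun y => x * y) (isRegularMap_mul_left x) (matrixCoeff hρ l v) =
      matrixCoeff hρ (l ∘ₗ ρ x) v := by
    apply Subtype.ext
    funext y
    simp [pullback_apply, matrixCoeff_apply]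
  rw [h, ← dual_repDeriv]
  rfl

theorem iterate_matrixCoeff (hρ : IsAlgebraicRep ρ) (D : lieAlg K) (l : Dual ℂ F) (v : F)
    (k : ℕ) :
    (D : Derivation ℂ (coordRing K) (coordRing K))^[k] (matrixCoeff hρ l v) =
      matrixCoeff hρ l ((repDeriv hρ D ^ k) v) := by
  induction k generalizing v with
  | zero => rfl
  | succ k ih => rw [Function.iterate_succ_apply, lieAlg_matrixCoeff, ih, pow_succ]; rfl

theorem repDeriv_lie (hρ : IsAlgebraicRep ρ) (D E : lieAlg K) :
    repDeriv hρ ((⁅D, E⁆ : lieAlg K) : Derivation ℂ (coordRing K) (coordRing K)) =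
      repDeriv hρ D * repDeriv hρ E - repDeriv hρ E * repDeriv hρ D := by
  refine LinearMap.ext fun v => eq_of_forall_dual fun l => ?_
  rw [dual_repDeriv, LieSubalgebra.coe_bracket, Derivation.commutator_apply,
    lieAlg_matrixCoeff, lieAlg_matrixCoeff, lieAlg_matrixCoeff, lieAlg_matrixCoeff,
    LinearMap.sub_apply, map_sub]
  change l (ρ 1 _) - l (ρ 1 _) = _
  rw [map_one]
  rfl

/-- The differential of an algebraic representation. -/
def repDifferential (hρ : IsAlgebraicRep ρ) : lieAlg K →ₗ⁅ℂ⁆ End ℂ F where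
  toFun D := repDeriv hρ D
  map_add' D E := LinearMap.ext fun v => eq_of_forall_dual fun l => by
    rw [LinearMap.add_apply, map_add, dual_repDeriv, dual_repDeriv, dual_repDeriv]
    rfl
  map_smul' c D := LinearMap.ext fun v => eq_of_forall_dual fun l => by
    rw [RingHom.id_apply, LinearMap.smul_apply, map_smul, dual_repDeriv, dual_repDeriv]
    rfl
  map_lie' {D E} := repDeriv_lie hρ D E

theorem repDifferential_apply (hρ : IsAlgebraicRep ρ) (D : lieAlg K) :
    repDifferential hρ D = repDeriv hρ D := rfl

theorem dual_repDifferential (hρ : IsAlgebraicRep ρ) (D : lieAlg K)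
    (l : Dual ℂ F) (v : F) : l (repDifferential hρ D v) =
      ((D : Derivation ℂ (coordRing K) (coordRing K)) (matrixCoeff hρ l v) : K → ℂ) 1 :=
  dual_repDeriv hρ D l v

theorem repDifferential_Ad (hρ : IsAlgebraicRep ρ) (x : K) (D : lieAlg K) (v : F) :
    repDifferential hρ (Ad x D) v = ρ x (repDifferential hρ D (ρ x⁻¹ v)) := by
  refine eq_of_forall_dual fun l => ?_
  rw [dual_repDifferential, Ad_apply_apply]
  have h : pullback _ (innerAut x).regular (matrixCoeff hρ l v) =
      matrixCoeff hρ (l ∘ₗ ρ x) (ρ x⁻¹ v) := by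
    apply Subtype.ext
    funext y
    simp [pullback_apply, matrixCoeff_apply, innerAut]
  have h1 : x⁻¹ * 1 * x = 1 := by group
  rw [h, h1, ← dual_repDifferential]
  rfl

end Rep

variable (K) in
/-- The tautological representation of a linear group. -/
def stdRep : Representation ℂ K (Fin n → ℂ) where
  toFun x := Matrix.toLin' ((x : GL (Fin n) ℂ) : Matrix (Fin n) (Fin n) ℂ)
  map_one' := Matrix.toLin'_one
  map_mul' _ _ := Matrix.toLin'_mul _ _

theorem stdRep_apply (x : K) (v : Fin n → ℂ) (i : Fin n) :
    stdRep K x v i = ∑ j, entry K i j x * v j := rfl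

variable (K) in
theorem isAlgebraicRep_stdRep : IsAlgebraicRep (stdRep K) := by
  intro l v
  have : (fun x : K => l (stdRep K x v)) =
      ∑ i, ∑ j, (l (Pi.single i 1) * v j) • entry K i j := by
    funext x
    rw [LinearMap.pi_apply_eq_sum_univ l]
    simp only [stdRep_apply, Finset.sum_apply, Pi.smul_apply, smul_eq_mul, Finset.sum_mul]
    refine Finset.sum_congr rfl fun i _ => Finset.sum_congr rfl fun j _ => ?_
    have : (fun j => if i = j then (1 : ℂ) else 0) = Pi.single i 1 := by
      funext j
      simp [Pi.single_apply, eq_comm]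
    rw [this]
    ring
  rw [this]
  exact Subalgebra.sum_mem _ fun i _ => Subalgebra.sum_mem _ fun j _ =>
    (coordRing K).smul_mem (entry_mem i j) _

/-- The entries of `x` as elements of the coordinate ring. -/
def entryCoord (i j : Fin n) : coordRing K := ⟨entry K i j, entry_mem i j⟩

/-- The entries of `x⁻¹` as elements of the coordinate ring. -/
def invEntryCoord (i j : Fin n) : coordRing K := ⟨invEntry K i j, invEntry_mem i j⟩

theorem entry_one (i j : Fin n) : entry K i j 1 = (1 : Matrix (Fin n) (Fin n) ℂ) i j := rfl

theorem invEntry_one (i j : Fin n) : invEntry K i j 1 = (1 : Matrix (Fin n) (Fin n) ℂ) i j := by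
  simp [invEntry]

variable (K) in
/-- The universal point of `K`. -/
def entryMatrix : Matrix (Fin n) (Fin n) (coordRing K) := Matrix.of entryCoord

variable (K) in
/-- The inverse of the universal point of `K`. -/
def invEntryMatrix : Matrix (Fin n) (Fin n) (coordRing K) := Matrix.of invEntryCoord

theorem entryMatrix_mul_invEntryMatrix : entryMatrix K * invEntryMatrix K = 1 := by
  refine Matrix.ext fun i j => ?_
  apply Subtype.ext
  funext x
  have : (((x : GL (Fin n) ℂ) : Matrix (Fin n) (Fin n) ℂ) *
      (((x⁻¹ : K) : GL (Fin n) ℂ) : Matrix (Fin n) (Fin n) ℂ)) i j =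
      (1 : Matrix (Fin n) (Fin n) ℂ) i j := by
    rw [← Units.val_mul, ← Subgroup.coe_mul, mul_inv_cancel]; rfl
  rw [Matrix.mul_apply, Matrix.one_apply] at this
  rw [Matrix.mul_apply, Matrix.one_apply]
  simp only [AddSubmonoidClass.coe_finsetSum, Finset.sum_apply]
  refine this.trans ?_
  split_ifs <;> rfl

/-- The derivative of the inverse of a matrix. -/
theorem map_derivation_inverse {A : Type*} [CommRing A] [Algebra ℂ A] (δ : Derivation ℂ A A)
    {E E' : Matrix (Fin n) (Fin n) A} (h : E * E' = 1) (X : Matrix (Fin n) (Fin n) A)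
    (hX : E.map δ = E * X) : E'.map δ = -(X * E') := by
  have h' : E' * E = 1 := mul_eq_one_comm.1 h
  have h1 : E.map δ * E' + E * E'.map δ = 0 := by
    ext i j
    have := congrArg δ (congrFun (congrFun h i) j)
    rw [Matrix.mul_apply, map_sum, Matrix.one_apply] at this
    have h0 : δ (if i = j then 1 else 0) = 0 := by split_ifs <;> simp
    rw [h0] at this
    rw [Matrix.add_apply, Matrix.mul_apply, Matrix.mul_apply, ← Finset.sum_add_distrib,
      Matrix.zero_apply, ← this]
    refine Finset.sum_congr rfl fun k _ => ?_
    rw [Derivation.leibniz, Matrix.map_apply, Matrix.map_apply, smul_eq_mul, smul_eq_mul]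
    ring
  have h2 := congrArg (E' * ·) h1
  simp only [mul_add, mul_zero, hX, ← mul_assoc, h', one_mul] at h2
  exact eq_neg_of_add_eq_zero_right h2

/-- Induction for `ℂ[K]` as a type. -/
theorem coordRing_induction {p : coordRing K → Prop} (f : coordRing K)
    (entry : ∀ i j, p (entryCoord i j)) (inv : ∀ i j, p (invEntryCoord i j))
    (const : ∀ r, p (algebraMap ℂ _ r)) (add : ∀ f g, p f → p g → p (f + g))
    (mul : ∀ f g, p f → p g → p (f * g)) : p f := by
  obtain ⟨f, hf⟩ := f
  induction hf using Algebra.adjoin_induction with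
  | mem f hf =>
    rcases hf with ⟨i, j, rfl⟩ | ⟨i, j, rfl⟩
    · exact entry i j
    · exact inv i j
  | algebraMap r => exact const r
  | add f g _ _ hf hg => exact add _ _ hf hg
  | mul f g _ _ hf hg => exact mul _ _ hf hg

/-- The matrix which corresponds to an element of the Lie algebra. -/
def lieMatrix (D : lieAlg K) : Matrix (Fin n) (Fin n) ℂ :=
  Matrix.of fun i j =>
    ((D : Derivation ℂ (coordRing K) (coordRing K)) (entryCoord i j) : K → ℂ) 1

variable (K) in
/-- The differential of the tautological representation. -/
def stdDifferential : lieAlg K →ₗ⁅ℂ⁆ End ℂ (Fin n → ℂ) := repDifferential (isAlgebraicRep_stdRep K)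

theorem matrixCoeff_stdRep (i j : Fin n) :
    matrixCoeff (isAlgebraicRep_stdRep K) (LinearMap.proj i) (Pi.single j 1) = entryCoord i j := by
  apply Subtype.ext
  funext x
  rw [matrixCoeff_apply, LinearMap.proj_apply, stdRep_apply]
  simp [Pi.single_apply, entryCoord]

theorem stdDifferential_single (D : lieAlg K) (i j : Fin n) :
    stdDifferential K D (Pi.single j 1) i = lieMatrix D i j := by
  have := dual_repDifferential (isAlgebraicRep_stdRep K) D (LinearMap.proj i) (Pi.single j 1)
  rw [matrixCoeff_stdRep] at this
  exact this

theorem stdDifferential_eq (D : lieAlg K) : stdDifferential K D = Matrix.toLin' (lieMatrix D) := by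
  refine LinearMap.pi_ext' fun j => LinearMap.ext_ring ?_
  funext i
  simp [stdDifferential_single]

theorem lieAlg_entryCoord (D : lieAlg K) (i j : Fin n) :
    (D : Derivation ℂ (coordRing K) (coordRing K)) (entryCoord i j) =
      ∑ k, lieMatrix D k j • entryCoord i k := by
  rw [← matrixCoeff_stdRep, lieAlg_matrixCoeff]
  apply Subtype.ext
  funext x
  rw [matrixCoeff_apply, LinearMap.proj_apply, stdRep_apply]
  simp only [AddSubmonoidClass.coe_finsetSum, Finset.sum_apply]
  refine Finset.sum_congr rfl fun k _ => ?_
  have := stdDifferential_single D k j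
  rw [stdDifferential, repDifferential_apply] at this
  rw [this]
  exact mul_comm _ _

theorem lieAlg_invEntryCoord (D : lieAlg K) (i j : Fin n) :
    (D : Derivation ℂ (coordRing K) (coordRing K)) (invEntryCoord i j) =
      - ∑ k, lieMatrix D i k • invEntryCoord k j := by
  have h := map_derivation_inverse (D : Derivation ℂ (coordRing K) (coordRing K))
    entryMatrix_mul_invEntryMatrix ((lieMatrix D).map (algebraMap ℂ _)) (by
      ext1 i j
      refine (lieAlg_entryCoord D i j).trans ?_
      rw [Matrix.mul_apply]
      refine Finset.sum_congr rfl fun k _ => ?_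
      rw [Algebra.smul_def, mul_comm]
      rfl)
  refine (congrFun (congrFun h i) j).trans ?_
  rw [Matrix.neg_apply, Matrix.mul_apply]
  congr 1

/-- Elements of the Lie algebra are determined by their matrices. -/
theorem lieMatrix_injective (D : lieAlg K) (h : lieMatrix D = 0) : D = 0 := by
  apply Subtype.ext
  apply Derivation.ext
  intro f
  change (D : Derivation ℂ (coordRing K) (coordRing K)) f = 0
  induction f using coordRing_induction with
  | entry i j => rw [lieAlg_entryCoord, h]; simp
  | inv i j => rw [lieAlg_invEntryCoord, h]; simp
  | const r => exact Derivation.map_algebraMap _ r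
  | add f g hf hg => rw [map_add, hf, hg, add_zero]
  | mul f g hf hg => rw [Derivation.leibniz, hf, hg, smul_zero, smul_zero, add_zero]

theorem stdDifferential_injective : Function.Injective (stdDifferential K) := by
  rw [injective_iff_map_eq_zero]
  intro D hD
  apply lieMatrix_injective
  ext i j
  rw [← stdDifferential_single, hD]
  rfl

instance finiteDimensional_lieAlg : FiniteDimensional ℂ (lieAlg K) :=
  FiniteDimensional.of_injective (stdDifferential K : lieAlg K →ₗ[ℂ] End ℂ (Fin n → ℂ))
    stdDifferential_injective

end LinAlgGrp

/-! ### Tangent vectors at the identity and subspaces stable under the Lie algebra -/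

namespace LinAlgGrp

open Module

attribute [local instance] LieRing.ofAssociativeRing

variable {n : ℕ} {K : Subgroup (GL (Fin n) ℂ)}

/-- Left translation of regular functions. -/
abbrev leftPullback (x : K) : coordRing K →ₐ[ℂ] coordRing K :=
  pullback (fun y => x * y) (isRegularMap_mul_left x)

/-- The point derivation rule yields a product rule for these functions, so regularity reduces to
the generators, whose translates by x have coefficients regular in x. -/
theorem regular_apply_leftPullback (ξ : coordRing K →ₗ[ℂ] ℂ)
    (hξ : ∀ f g : coordRing K, ξ (f * g) = (f : K → ℂ) 1 * ξ g + (g : K → ℂ) 1 * ξ f)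
    (f : coordRing K) : (fun x => ξ (leftPullback x f)) ∈ coordRing K := by
  induction f using coordRing_induction with
  | entry i j =>
    have h : (fun x => ξ (leftPullback x (entryCoord i j))) =
        ∑ k, ξ (entryCoord k j) • entry K i k := by
      funext x
      have : leftPullback x (entryCoord i j) = ∑ k, entry K i k x • entryCoord k j := by
        apply Subtype.ext
        funext y
        simp only [AddSubmonoidClass.coe_finsetSum, Finset.sum_apply]
        exact Matrix.mul_apply
      rw [this, map_sum, Finset.sum_apply]
      refine Finset.sum_congr rfl fun k _ => ?_
      rw [map_smul, Pi.smul_apply, smul_eq_mul, smul_eq_mul, mul_comm]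
    rw [h]
    exact Subalgebra.sum_mem _ fun k _ => (coordRing K).smul_mem (entry_mem i k) _
  | inv i j =>
    have h : (fun x => ξ (leftPullback x (invEntryCoord i j))) =
        ∑ k, ξ (invEntryCoord i k) • invEntry K k j := by
      funext x
      have : leftPullback x (invEntryCoord i j) = ∑ k, invEntry K k j x • invEntryCoord i k := by
        apply Subtype.ext
        funext y
        simp only [AddSubmonoidClass.coe_finsetSum, Finset.sum_apply]
        change (((((x * y)⁻¹ : K) : GL (Fin n) ℂ) : Matrix (Fin n) (Fin n) ℂ)) i j = _
        rw [mul_inv_rev, Subgroup.coe_mul, Units.val_mul, Matrix.mul_apply]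
        exact Finset.sum_congr rfl fun k _ => mul_comm _ _
      rw [this, map_sum, Finset.sum_apply]
      refine Finset.sum_congr rfl fun k _ => ?_
      rw [map_smul, Pi.smul_apply, smul_eq_mul, smul_eq_mul, mul_comm]
    rw [h]
    exact Subalgebra.sum_mem _ fun k _ => (coordRing K).smul_mem (invEntry_mem k j) _
  | const r =>
    have h1 : ξ 1 = 0 := by
      have := hξ 1 1
      have e : ((1 : coordRing K) : K → ℂ) 1 = 1 := rfl
      rw [mul_one, e] at this
      linear_combination -this
    have h : (fun x => ξ (leftPullback x (algebraMap ℂ (coordRing K) r))) = 0 := by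
      funext x
      rw [AlgHom.commutes, Algebra.algebraMap_eq_smul_one, map_smul, h1, smul_zero]
      rfl
    rw [h]
    exact zero_mem _
  | add f g hf hg =>
    simp only [map_add]
    exact add_mem hf hg
  | mul f g hf hg =>
    have h : (fun x => ξ (leftPullback x (f * g))) =
        (f : K → ℂ) * (fun x => ξ (leftPullback x g)) +
          (g : K → ℂ) * (fun x => ξ (leftPullback x f)) := by
      funext x
      rw [map_mul, hξ, pullback_apply, pullback_apply, mul_one]
      rfl
    rw [h]
    exact add_mem (mul_mem f.2 hg) (mul_mem g.2 hf)

/-- Point derivations at the identity extend to left invariant derivations. -/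
theorem exists_lieAlg_of_pointDerivation (ξ : coordRing K →ₗ[ℂ] ℂ)
    (hξ : ∀ f g : coordRing K, ξ (f * g) = (f : K → ℂ) 1 * ξ g + (g : K → ℂ) 1 * ξ f) :
    ∃ D : lieAlg K, ∀ f,
      ((D : Derivation ℂ (coordRing K) (coordRing K)) f : K → ℂ) 1 = ξ f := by
  let δ : Derivation ℂ (coordRing K) (coordRing K) := Derivation.mk'
    { toFun := fun f => ⟨fun x => ξ (leftPullback x f), regular_apply_leftPullback ξ hξ f⟩
      map_add' := fun f g => by
        apply Subtype.ext
        funext x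
        exact (congrArg ξ (map_add _ f g)).trans (map_add _ _ _)
      map_smul' := fun c f => by
        apply Subtype.ext
        funext x
        exact (congrArg ξ (map_smul _ c f)).trans (map_smul _ _ _) }
    (by
      intro f g
      apply Subtype.ext
      funext x
      change ξ (leftPullback x (f * g)) =
        (f : K → ℂ) x * ξ (leftPullback x g) + (g : K → ℂ) x * ξ (leftPullback x f)
      rw [map_mul, hξ, pullback_apply, pullback_apply, mul_one])
  refine ⟨⟨δ, ?_⟩, ?_⟩
  · intro x f
    apply Subtype.ext
    funext y
    change ξ (leftPullback y (leftPullback x f)) = ξ (leftPullback (x * y) f)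
    congr 1
    apply Subtype.ext
    funext z
    simp only [pullback_apply, mul_assoc]
  · intro f
    change ξ (leftPullback 1 f) = ξ f
    congr 1
    apply Subtype.ext
    funext z
    simp only [pullback_apply, one_mul]

theorem lieAlg_eq_zero_of_apply_one (D : lieAlg K)
    (h : ∀ f, ((D : Derivation ℂ (coordRing K) (coordRing K)) f : K → ℂ) 1 = 0) : D = 0 := by
  apply Subtype.ext
  apply Derivation.ext
  intro f
  apply Subtype.ext
  funext x
  rw [lieAlg_apply_eq, h]
  rfl

variable (K) in
/-- The maximal ideal of the identity. -/
def idealOne : Ideal (coordRing K) := RingHom.ker (evalHom (1 : K))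

theorem mem_idealOne {f : coordRing K} : f ∈ idealOne K ↔ (f : K → ℂ) 1 = 0 := Iff.rfl

/-- A regular function whose value and differential at the identity vanish belongs to the square
of the maximal ideal. -/
theorem mem_idealOne_sq {g : coordRing K} (hg : (g : K → ℂ) 1 = 0)
    (h : ∀ D : lieAlg K, ((D : Derivation ℂ (coordRing K) (coordRing K)) g : K → ℂ) 1 = 0) :
    g ∈ idealOne K ^ 2 := by
  by_contra hn
  -- A functional that kills the squared maximal ideal and the constants is a point derivation; one
  -- not killing g would come from a D that contradicts `h`.
  let S : Submodule ℂ (coordRing K) :=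
    (idealOne K ^ 2).restrictScalars ℂ ⊔ Submodule.span ℂ {1}
  have hgS : g ∉ S := by
    intro hS
    obtain ⟨a, ha, b, hb, hab⟩ := Submodule.mem_sup.1 hS
    obtain ⟨c, rfl⟩ := Submodule.mem_span_singleton.1 hb
    have ha' : a ∈ idealOne K ^ 2 := ha
    have ha1 : (a : K → ℂ) 1 = 0 := mem_idealOne.1 (Ideal.pow_le_self two_ne_zero ha')
    have : (a : K → ℂ) 1 + c * 1 = (g : K → ℂ) 1 := congrArg (fun f : coordRing K => (f : K → ℂ) 1) hab
    have hc : c = 0 := by rw [ha1, hg] at this; linear_combination this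
    rw [hc, zero_smul, add_zero] at hab
    exact hn (hab ▸ ha')
  obtain ⟨ξ, hξg, hξS⟩ := Submodule.exists_le_ker_of_notMem hgS
  obtain ⟨D, hD⟩ := exists_lieAlg_of_pointDerivation ξ (by
    intro f g
    let a : coordRing K := algebraMap ℂ _ ((f : K → ℂ) 1)
    let b : coordRing K := algebraMap ℂ _ ((g : K → ℂ) 1)
    have ha : f - a ∈ idealOne K := mem_idealOne.2 (sub_self ((f : K → ℂ) 1))
    have hb : g - b ∈ idealOne K := mem_idealOne.2 (sub_self ((g : K → ℂ) 1))
    have h1 : (f - a) * (g - b) - (((f : K → ℂ) 1) * ((g : K → ℂ) 1)) • (1 : coordRing K) ∈ S := by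
      refine sub_mem (Submodule.mem_sup_left ?_) (Submodule.mem_sup_right
        (Submodule.smul_mem _ _ (Submodule.mem_span_singleton_self _)))
      change (f - a) * (g - b) ∈ idealOne K ^ 2
      rw [pow_two]
      exact Ideal.mul_mem_mul ha hb
    have h2 : f * g - ((f : K → ℂ) 1) • g - ((g : K → ℂ) 1) • f =
        (f - a) * (g - b) - (((f : K → ℂ) 1) * ((g : K → ℂ) 1)) • (1 : coordRing K) := by
      simp only [a, b, Algebra.smul_def, map_mul]
      ring
    rw [← h2] at h1
    have h3 := hξS h1
    rw [LinearMap.mem_ker, map_sub, map_sub, map_smul, map_smul, smul_eq_mul, smul_eq_mul] at h3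
    linear_combination h3)
  exact hξg ((hD g).symm.trans (h D))

section Euler

variable {A L : Type*} [CommRing A] [Algebra ℂ A] [AddCommGroup L] [Module ℂ L]
  (ε : A →ₐ[ℂ] ℂ) (δ : L →ₗ[ℂ] Derivation ℂ A A)

/-- The pairing of derivations and functions at a point. -/
def pointPairing : L →ₗ[ℂ] A →ₗ[ℂ] ℂ :=
  LinearMap.mk₂ ℂ (fun D f => ε (δ D f))
    (fun D E f => by rw [map_add, Derivation.add_apply, map_add])
    (fun c D f => by rw [map_smul, Derivation.smul_apply, map_smul])
    (fun D f g => by rw [map_add, map_add])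
    (fun c D f => by rw [Derivation.map_smul, map_smul])

theorem pointPairing_apply (D : L) (f : A) : pointPairing ε δ D f = ε (δ D f) := rfl

variable [FiniteDimensional ℂ L]

/-- Functions dual to a basis of a space of derivations. -/
theorem exists_dual_functions (hinj : ∀ D, (∀ f, ε (δ D f) = 0) → D = 0) :
    ∃ x : Fin (finrank ℂ L) → A, (∀ i, ε (x i) = 0) ∧
      ∀ i j, ε (δ (finBasis ℂ L i) (x j)) = if i = j then 1 else 0 := by
  set b := finBasis ℂ L
  let T : A →ₗ[ℂ] (Fin (finrank ℂ L) → ℂ) := LinearMap.pi fun i => pointPairing ε δ (b i)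
  have hT : LinearMap.range T = ⊤ := by
    by_contra hne
    obtain ⟨ψ, hψ0, hψ⟩ := Submodule.exists_le_ker_of_lt_top _ (lt_top_iff_ne_top.2 hne)
    -- A functional ψ on the coordinate space that kills the range is a combination of basis
    -- derivations vanishing at the point, so its coefficients are zero.
    have hz : ∑ i, ψ (Pi.single i 1) • b i = 0 := by
      apply hinj
      intro f
      have h1 : ψ (T f) = 0 := hψ ⟨f, rfl⟩
      rw [LinearMap.pi_apply_eq_sum_univ ψ] at h1
      rw [← pointPairing_apply, map_sum, LinearMap.sum_apply, ← h1]
      refine Finset.sum_congr rfl fun i _ => ?_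
      have h3 : (fun j => if i = j then (1 : ℂ) else 0) = Pi.single i 1 := by
        funext j
        simp [Pi.single_apply, eq_comm]
      rw [h3, map_smul]
      exact mul_comm _ _
    have hz' := Fintype.linearIndependent_iff.1 b.linearIndependent _ hz
    exact hψ0 (LinearMap.pi_ext' fun i => LinearMap.ext_ring (hz' i))
  have hsurj := LinearMap.range_eq_top.1 hT
  choose y hy using fun j => hsurj (Pi.single j 1)
  refine ⟨fun j => y j - algebraMap ℂ _ (ε (y j)), fun i => ?_, fun i j => ?_⟩
  · rw [map_sub, AlgHom.commutes]
    exact sub_self _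
  · rw [map_sub, Derivation.map_algebraMap, sub_zero]
    have := congrFun (hy j) i
    rw [Pi.single_apply] at this
    exact this

/-- Let `δ` be a space of derivations which separates tangent directions at a point. A set of
functions which vanish at the point and which is stable under `δ` consists of functions which
vanish in a neighbourhood. -/
theorem exists_mul_eq_zero_of_derivation_stable [IsNoetherianRing A]
    (hinj : ∀ D, (∀ f, ε (δ D f) = 0) → D = 0)
    (hsq : ∀ g, ε g = 0 → (∀ D, ε (δ D g) = 0) → g ∈ RingHom.ker ε ^ 2)
    (I : Set A) (h1 : ∀ f ∈ I, ε f = 0) (hD : ∀ f ∈ I, ∀ D, δ D f ∈ I)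
    {f : A} (hf : f ∈ I) : ∃ g, ε g ≠ 0 ∧ g * f = 0 := by
  obtain ⟨x, hx1, hx⟩ := exists_dual_functions ε δ hinj
  set b := finBasis ℂ L
  set m := RingHom.ker ε with hm
  -- This is the Euler field in the local coordinates `x`; it acts on m^k/m^(k+1) as multiplication
  -- by k.
  let E : Derivation ℂ A A := ∑ i, x i • δ (b i)
  have hE : ∀ f, E f = ∑ i, x i * δ (b i) f := by
    intro f
    change (∑ i, x i • δ (b i)) f = _
    rw [← Derivation.coeFnAddMonoidHom_apply, map_sum, Finset.sum_apply]
    rfl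
  have hbase : ∀ f ∈ m, E f - f ∈ m ^ 2 := by
    intro f hf
    let c : Fin (finrank ℂ L) → ℂ := fun i => ε (δ (b i) f)
    let g := f - ∑ i, c i • x i
    have hg : g ∈ m ^ 2 := by
      refine hsq g ?_ fun D => ?_
      · simp [g, hx1, show ε f = 0 from hf]
      · have : (pointPairing ε δ).flip g = 0 := by
          refine b.ext fun j => ?_
          rw [LinearMap.flip_apply, map_sub, map_sum]
          simp only [map_smul, pointPairing_apply, hx]
          simp [c]
        exact congrArg (fun ψ => ψ D) this
    have e : E f - f = ∑ i, x i * (δ (b i) f - algebraMap ℂ _ (c i)) - g := by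
      rw [hE]
      simp only [g, mul_sub, Finset.sum_sub_distrib, Algebra.smul_def]
      have : ∑ i, x i * algebraMap ℂ A (c i) = ∑ i, algebraMap ℂ A (c i) * x i :=
        Finset.sum_congr rfl fun i _ => mul_comm _ _
      rw [this]
      ring
    rw [e]
    refine sub_mem (sum_mem fun i _ => ?_) hg
    rw [pow_two]
    refine Ideal.mul_mem_mul (hx1 i) ?_
    rw [RingHom.mem_ker, map_sub, AlgHom.commutes]
    exact sub_self _
  have hpow : ∀ k : ℕ, ∀ f ∈ m ^ k, E f - (k : ℂ) • f ∈ m ^ (k + 1) := by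
    intro k
    induction k with
    | zero =>
      intro f _
      rw [Nat.cast_zero, zero_smul, sub_zero, zero_add, pow_one, hE]
      exact sum_mem fun i _ => Ideal.mul_mem_right _ _ (hx1 i)
    | succ k ih =>
      intro f hf
      rw [pow_succ] at hf
      induction hf using Submodule.mul_induction_on' with
      | mem_mul_mem a ha c hc =>
        have e : E (a * c) - ((k + 1 : ℕ) : ℂ) • (a * c) =
            a * (E c - c) + (E a - (k : ℂ) • a) * c := by
          rw [Derivation.leibniz, smul_eq_mul, smul_eq_mul]
          simp only [Algebra.smul_def]
          push_cast
          ring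
        rw [e]
        refine add_mem ?_ ?_
        · rw [show k + 1 + 1 = k + 2 from rfl, pow_add]
          exact Ideal.mul_mem_mul ha (hbase c hc)
        · rw [pow_succ]
          exact Ideal.mul_mem_mul (ih a ha) hc
      | add a _ c _ ha hc =>
        have e : E (a + c) - ((k + 1 : ℕ) : ℂ) • (a + c) =
            (E a - ((k + 1 : ℕ) : ℂ) • a) + (E c - ((k + 1 : ℕ) : ℂ) • c) := by
          rw [map_add, smul_add]; abel
        rw [e]
        exact add_mem ha hc
  have hI : ∀ k : ℕ, ∀ f ∈ I, f ∈ m ^ (k + 1) := by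
    intro k
    induction k with
    | zero => intro f hf; rw [zero_add, pow_one]; exact h1 f hf
    | succ k ih =>
      intro f hf
      have e1 := hpow (k + 1) f (ih f hf)
      -- The derivatives of f lie in I, hence in m^(k+1), and the coefficients of E lie in m. Since
      -- E f agrees with (k+1)f modulo m^(k+2), f gains one order of vanishing.
      have e2 : E f ∈ m ^ (k + 1 + 1) := by
        rw [hE, pow_succ']
        exact sum_mem fun i _ => Ideal.mul_mem_mul (hx1 i) (ih _ (hD f hf (b i)))
      have e3 : ((k + 1 : ℕ) : ℂ) • f ∈ m ^ (k + 1 + 1) := by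
        have := sub_mem e2 e1
        rwa [sub_sub_cancel] at this
      have hk : ((k + 1 : ℕ) : ℂ) ≠ 0 := by exact_mod_cast k.succ_ne_zero
      have := Submodule.smul_of_tower_mem (m ^ (k + 1 + 1)) ((k + 1 : ℕ) : ℂ)⁻¹ e3
      rwa [inv_smul_smul₀ hk] at this
  have hinf : f ∈ (⨅ i : ℕ, m ^ i • ⊤ : Submodule A A) := by
    rw [Submodule.mem_iInf]
    intro i
    rw [smul_eq_mul, Ideal.mul_top]
    exact Ideal.pow_le_pow_right i.le_succ (hI i f hf)
  obtain ⟨r, hr⟩ := (Ideal.mem_iInf_smul_pow_eq_bot_iff m f).1 hinf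
  refine ⟨1 - r, ?_, ?_⟩
  · rw [map_sub, map_one, show ε (r : A) = 0 from r.2, sub_zero]
    exact one_ne_zero
  · rw [sub_mul, one_mul]
    exact sub_eq_zero.2 hr.symm

end Euler

/-- A set of regular functions which vanish at the identity, stable under the Lie algebra, consists
of functions which vanish in a neighbourhood of the identity. -/
theorem exists_mul_eq_zero_of_lieAlg_stable (I : Set (coordRing K))
    (h1 : ∀ f ∈ I, (f : K → ℂ) 1 = 0)
    (hD : ∀ f ∈ I, ∀ D : lieAlg K, (D : Derivation ℂ (coordRing K) (coordRing K)) f ∈ I)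
    {f : coordRing K} (hf : f ∈ I) : ∃ g : coordRing K, (g : K → ℂ) 1 ≠ 0 ∧ g * f = 0 := by
  have : IsNoetherianRing (coordRing K) := Algebra.FiniteType.isNoetherianRing ℂ _
  exact exists_mul_eq_zero_of_derivation_stable (evalHom (1 : K))
    ((lieAlg K).incl : lieAlg K →ₗ[ℂ] Derivation ℂ (coordRing K) (coordRing K))
    lieAlg_eq_zero_of_apply_one (fun g hg h => mem_idealOne_sq hg h) I h1 hD hf

section Rep

variable {F : Type*} [AddCommGroup F] [Module ℂ F] {ρ : Representation ℂ K F}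
  [FiniteDimensional ℂ F]

theorem map_eq_of_le (x : K) (M : Submodule ℂ F) (h : M.map (ρ x) ≤ M) : M.map (ρ x) = M := by
  refine Submodule.eq_of_le_of_finrank_eq h ?_
  refine (Submodule.equivMapOfInjective (ρ x) (fun v w hvw => ?_) M).finrank_eq.symm
  have := congrArg (ρ x⁻¹) hvw
  simpa using this

theorem isOpen_ne_zero (f : coordRing K) :
    IsOpen[zariskiTopology K] {x : K | (f : K → ℂ) x ≠ 0} :=
  TopologicalSpace.isOpen_generateFrom_of_mem ⟨f, f.2, rfl⟩

/-- A subspace which is stable under the Lie algebra is stable under the identity component. -/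
theorem map_eq_of_mem_connectedComponent (hρ : IsAlgebraicRep ρ) (M : Submodule ℂ F)
    (hM : ∀ D : lieAlg K, ∀ v ∈ M, repDifferential hρ D v ∈ M) (x y : K)
    (hy : y ∈ @connectedComponent K (zariskiTopology K) x) : M.map (ρ (x⁻¹ * y)) = M := by
  -- The common zeros of these coefficients are the x with ρ(x)M ⊆ M.
  let I : Set (coordRing K) := {f | ∃ l ∈ M.dualAnnihilator, ∃ v ∈ M, f = matrixCoeff hρ l v}
  have hI : ∀ f ∈ I, ∃ g : coordRing K, (g : K → ℂ) 1 ≠ 0 ∧ g * f = 0 := by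
    intro f hf
    refine exists_mul_eq_zero_of_lieAlg_stable I ?_ ?_ hf
    · rintro _ ⟨l, hl, v, hv, rfl⟩
      rw [matrixCoeff_apply, map_one]
      exact (Submodule.mem_dualAnnihilator l).1 hl v hv
    · rintro _ ⟨l, hl, v, hv, rfl⟩ D
      rw [lieAlg_matrixCoeff]
      exact ⟨l, hl, _, hM D v hv, rfl⟩
  let bl := finBasis ℂ M.dualAnnihilator
  let bv := finBasis ℂ M
  have hij : ∀ i j, ∃ g : coordRing K, (g : K → ℂ) 1 ≠ 0 ∧
      g * matrixCoeff hρ (bl i) (bv j) = 0 := fun i j =>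
    hI _ ⟨bl i, (bl i).2, bv j, (bv j).2, rfl⟩
  choose g hg1 hg using hij
  -- Bases reduce the equations to finitely many, so one product describes a neighbourhood of 1
  -- inside the stabilizer of M.
  let G : coordRing K := ∏ i, ∏ j, g i j
  have hGx : ∀ x, (G : K → ℂ) x = ∏ i, ∏ j, (g i j : K → ℂ) x := by
    intro x
    refine (map_prod (evalHom x) (fun i => ∏ j, g i j) Finset.univ).trans ?_
    exact Finset.prod_congr rfl fun i _ => map_prod (evalHom x) _ _
  have hG1 : (G : K → ℂ) 1 ≠ 0 := by
    rw [hGx]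
    exact Finset.prod_ne_zero_iff.2 fun i _ => Finset.prod_ne_zero_iff.2 fun j _ => hg1 i j
  have hG : ∀ x, (G : K → ℂ) x ≠ 0 → M.map (ρ x) = M := by
    intro x hx
    apply map_eq_of_le
    rw [hGx, Finset.prod_ne_zero_iff] at hx
    have hz : ∀ i j, (bl i : Dual ℂ F) (ρ x (bv j)) = 0 := by
      intro i j
      have h1 := Finset.prod_ne_zero_iff.1 (hx i (Finset.mem_univ i)) j (Finset.mem_univ j)
      have h2 : (g i j : K → ℂ) x * (bl i : Dual ℂ F) (ρ x (bv j)) = 0 :=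
        congrArg (fun f : coordRing K => (f : K → ℂ) x) (hg i j)
      exact (mul_eq_zero.1 h2).resolve_left h1
    rw [← Subspace.dualAnnihilator_dualCoannihilator_eq (W := M)]
    rintro _ ⟨v, hv, rfl⟩
    rw [Subspace.dualAnnihilator_dualCoannihilator_eq] at hv
    rw [Submodule.mem_dualCoannihilator]
    intro l hl
    let B : M.dualAnnihilator →ₗ[ℂ] M →ₗ[ℂ] ℂ :=
      LinearMap.mk₂ ℂ (fun l v => (l : Dual ℂ F) (ρ x v)) (fun _ _ _ => rfl) (fun _ _ _ => rfl)
        (fun l v w => by simp) (fun c l v => by simp)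
    have hB : B = 0 := bl.ext fun i => bv.ext fun j => hz i j
    exact congrArg (fun B => B ⟨l, hl⟩ ⟨v, hv⟩) hB
  let H : Subgroup K :=
    { carrier := {x | M.map (ρ x) = M}
      one_mem' := by
        change M.map (ρ 1) = M
        rw [map_one]
        exact Submodule.map_id M
      mul_mem' := fun {x y} hx hy => by
        change M.map (ρ (x * y)) = M
        rw [map_mul, Module.End.mul_eq_comp, Submodule.map_comp, hy, hx]
      inv_mem' := fun {x} hx => by
        change M.map (ρ x⁻¹) = M
        conv_lhs => rw [← show M.map (ρ x) = M from hx]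
        rw [← Submodule.map_comp, ← Module.End.mul_eq_comp, ← map_mul, inv_mul_cancel, map_one]
        exact Submodule.map_id M }
  have hGH : ∀ x, (G : K → ℂ) x ≠ 0 → x ∈ H := hG
  have hopen : ∀ z : K, IsOpen[zariskiTopology K] {w : K | (G : K → ℂ) (z⁻¹ * w) ≠ 0} := fun z =>
    isOpen_ne_zero (leftPullback z⁻¹ G)
  let _ := zariskiTopology K
  -- A subgroup containing a neighbourhood of 1 has open cosets, so each coset is closed as well.
  have hclopen : IsClopen {w : K | x⁻¹ * w ∈ H} := by
    constructor
    · rw [← isOpen_compl_iff, isOpen_iff_forall_mem_open]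
      intro z hz
      refine ⟨_, fun w hw hwH => hz ?_, hopen z, by simpa using hG1⟩
      have h1 : z⁻¹ * w ∈ H := hGH _ hw
      have h2 := H.mul_mem hwH (H.inv_mem h1)
      have e : x⁻¹ * w * (z⁻¹ * w)⁻¹ = x⁻¹ * z := by group
      rwa [e] at h2
    · rw [isOpen_iff_forall_mem_open]
      intro z hz
      refine ⟨_, fun w hw => ?_, hopen z, by simpa using hG1⟩
      have h1 : z⁻¹ * w ∈ H := hGH _ hw
      have h2 := H.mul_mem hz h1
      have e : x⁻¹ * z * (z⁻¹ * w) = x⁻¹ * w := by group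
      rwa [e] at h2
  have hx : x ∈ {w : K | x⁻¹ * w ∈ H} := by simp [H.one_mem]
  exact hclopen.connectedComponent_subset hx hy

end Rep

end LinAlgGrp

/-! ### Unipotent subgroups and their fixed vectors -/

namespace LinAlgGrp

open Module

variable {n : ℕ} {K : Subgroup (GL (Fin n) ℂ)}

/-! ### Powers of unipotent elements -/

/-- The entries of the powers of a unipotent matrix are polynomials in the exponent. -/
theorem exists_polynomial_pow_apply {N : Matrix (Fin n) (Fin n) ℂ} (h : IsNilpotent (N - 1))
    (i j : Fin n) : ∃ P : Polynomial ℂ, ∀ k : ℕ, (N ^ k) i j = P.eval (k : ℂ) := by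
  obtain ⟨d, hd⟩ := h
  -- Expand N^k binomially around 1; for fixed m the binomial coefficient is a polynomial in k.
  refine ⟨∑ m ∈ Finset.range d, Polynomial.C (((N - 1) ^ m) i j / (m.factorial : ℂ)) *
    descPochhammer ℂ m, fun k => ?_⟩
  have h1 : N ^ k = ∑ m ∈ Finset.range d, (k.choose m : ℂ) • (N - 1) ^ m := by
    have h2 : N ^ k = ∑ m ∈ Finset.range (k + 1), (k.choose m : ℂ) • (N - 1) ^ m := by
      conv_lhs => rw [← sub_add_cancel N 1]
      rw [(Commute.one_right (N - 1)).add_pow]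
      refine Finset.sum_congr rfl fun m _ => ?_
      rw [one_pow, mul_one, ← nsmul_eq_mul', Nat.cast_smul_eq_nsmul]
    rw [h2]
    have e1 : ∑ m ∈ Finset.range (k + 1), (k.choose m : ℂ) • (N - 1) ^ m =
        ∑ m ∈ Finset.range (k + 1 + d), (k.choose m : ℂ) • (N - 1) ^ m := by
      refine Finset.sum_subset (Finset.range_mono (Nat.le_add_right _ _)) fun m _ hm => ?_
      rw [Nat.choose_eq_zero_of_lt (by simpa using hm), Nat.cast_zero, zero_smul]
    have e2 : ∑ m ∈ Finset.range d, (k.choose m : ℂ) • (N - 1) ^ m =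
        ∑ m ∈ Finset.range (k + 1 + d), (k.choose m : ℂ) • (N - 1) ^ m := by
      refine Finset.sum_subset (Finset.range_mono (Nat.le_add_left _ _)) fun m _ hm => ?_
      rw [pow_eq_zero_of_le (by simpa using hm) hd, smul_zero]
    rw [e1, e2]
  rw [h1, Matrix.sum_apply, Polynomial.eval_finsetSum]
  refine Finset.sum_congr rfl fun m _ => ?_
  rw [Polynomial.eval_mul, Polynomial.eval_C, Nat.cast_choose_eq_descPochhammer_div,
    Matrix.smul_apply, smul_eq_mul]
  ring

theorem isNilpotent_inv_sub_one {v : K}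
    (hv : IsNilpotent (((v : GL (Fin n) ℂ) : Matrix (Fin n) (Fin n) ℂ) - 1)) :
    IsNilpotent ((((v⁻¹ : K) : GL (Fin n) ℂ) : Matrix (Fin n) (Fin n) ℂ) - 1) := by
  set N := ((v : GL (Fin n) ℂ) : Matrix (Fin n) (Fin n) ℂ)
  set N' := (((v⁻¹ : K) : GL (Fin n) ℂ) : Matrix (Fin n) (Fin n) ℂ)
  have h1 : N' * N = 1 := by
    simp only [N, N', ← Units.val_mul, ← Subgroup.coe_mul, inv_mul_cancel]
    rfl
  have h2 : N * N' = 1 := mul_eq_one_comm.1 h1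
  have e : N' - 1 = (-N') * (N - 1) := by
    rw [mul_sub, neg_mul, h1]
    noncomm_ring
  have hc : Commute (-N') (N - 1) := by
    refine Commute.sub_right (Commute.neg_left ?_) (Commute.one_right _)
    exact h1.trans h2.symm
  rw [e]
  exact hc.isNilpotent_mul_left hv

/-- A regular function is a polynomial in the exponent on the powers of a unipotent element. -/
theorem exists_polynomial_apply_pow {v : K}
    (hv : IsNilpotent (((v : GL (Fin n) ℂ) : Matrix (Fin n) (Fin n) ℂ) - 1)) (f : coordRing K) :
    ∃ P : Polynomial ℂ, ∀ k : ℕ, (f : K → ℂ) (v ^ k) = P.eval (k : ℂ) := by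
  induction f using coordRing_induction with
  | entry i j =>
    obtain ⟨P, hP⟩ := exists_polynomial_pow_apply hv i j
    refine ⟨P, fun k => ?_⟩
    rw [← hP]
    change (((v ^ k : K) : GL (Fin n) ℂ) : Matrix (Fin n) (Fin n) ℂ) i j = _
    rw [Subgroup.coe_pow, Units.val_pow_eq_pow_val]
  | inv i j =>
    obtain ⟨P, hP⟩ := exists_polynomial_pow_apply (isNilpotent_inv_sub_one hv) i j
    refine ⟨P, fun k => ?_⟩
    rw [← hP]
    change ((((v ^ k)⁻¹ : K) : GL (Fin n) ℂ) : Matrix (Fin n) (Fin n) ℂ) i j = _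
    rw [← inv_pow, Subgroup.coe_pow, Units.val_pow_eq_pow_val]
  | const r => exact ⟨Polynomial.C r, fun k => by rw [Polynomial.eval_C]; rfl⟩
  | add f g hf hg =>
    obtain ⟨P, hP⟩ := hf
    obtain ⟨Q, hQ⟩ := hg
    exact ⟨P + Q, fun k => by rw [Polynomial.eval_add, ← hP, ← hQ]; rfl⟩
  | mul f g hf hg =>
    obtain ⟨P, hP⟩ := hf
    obtain ⟨Q, hQ⟩ := hg
    exact ⟨P * Q, fun k => by rw [Polynomial.eval_mul, ← hP, ← hQ]; rfl⟩

/-- The sets `{f ≠ 0}` are a basis of the Zariski topology. -/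
theorem exists_ne_zero_subset {O : Set K} (hO : IsOpen[zariskiTopology K] O) {x : K}
    (hx : x ∈ O) : ∃ f : coordRing K, (f : K → ℂ) x ≠ 0 ∧ {y | (f : K → ℂ) y ≠ 0} ⊆ O := by
  change TopologicalSpace.GenerateOpen _ O at hO
  induction hO with
  | basic s hs =>
    obtain ⟨f, hf, rfl⟩ := hs
    exact ⟨⟨f, hf⟩, hx, subset_rfl⟩
  | univ => exact ⟨1, one_ne_zero, Set.subset_univ _⟩
  | inter s t _ _ ihs iht =>
    obtain ⟨f, hf, hfs⟩ := ihs hx.1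
    obtain ⟨g, hg, hgt⟩ := iht hx.2
    refine ⟨f * g, mul_ne_zero hf hg, fun y hy => ⟨hfs ?_, hgt ?_⟩⟩
    · exact left_ne_zero_of_mul hy
    · exact right_ne_zero_of_mul hy
  | sUnion S _ ih =>
    obtain ⟨s, hs, hxs⟩ := hx
    obtain ⟨f, hf, hfs⟩ := ih s hs hxs
    exact ⟨f, hf, hfs.trans (Set.subset_sUnion_of_mem hs)⟩

/-- Unipotent groups are connected. -/
theorem isConnected_of_isUnipotent {V : Subgroup K} (hV : IsUnipotent V) :
    @IsConnected K (zariskiTopology K) (V : Set K) := by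
  let _ := zariskiTopology K
  refine ⟨⟨1, V.one_mem⟩, isPreconnected_of_forall 1 fun v hv => ?_⟩
  -- The powers of v join 1 to v inside an irreducible set: regular functions restrict to
  -- polynomials in k, and a product of two nonzero polynomials is nonzero at some natural number.
  refine ⟨Set.range fun k : ℕ => v ^ k, ?_, ⟨0, pow_zero v⟩, ⟨1, pow_one v⟩,
    IsPreirreducible.isPreconnected ?_⟩
  · rintro _ ⟨k, rfl⟩
    exact V.pow_mem hv k
  · rintro O O' hO hO' ⟨_, ⟨k, rfl⟩, hk⟩ ⟨_, ⟨k', rfl⟩, hk'⟩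
    obtain ⟨f, hf, hfO⟩ := exists_ne_zero_subset hO hk
    obtain ⟨g, hg, hgO⟩ := exists_ne_zero_subset hO' hk'
    obtain ⟨P, hP⟩ := exists_polynomial_apply_pow (hV v hv) f
    obtain ⟨Q, hQ⟩ := exists_polynomial_apply_pow (hV v hv) g
    have hP0 : P ≠ 0 := by
      rintro rfl
      exact hf ((hP k).trans Polynomial.eval_zero)
    have hQ0 : Q ≠ 0 := by
      rintro rfl
      exact hg ((hQ k').trans Polynomial.eval_zero)
    have hPQ : P * Q ≠ 0 := mul_ne_zero hP0 hQ0
    obtain ⟨m, hm⟩ : ∃ m : ℕ, (P * Q).eval (m : ℂ) ≠ 0 := by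
      by_contra! hall
      exact hPQ (Polynomial.eq_zero_of_infinite_isRoot _
        ((Set.infinite_range_of_injective (Nat.cast_injective (R := ℂ))).mono (by
          rintro _ ⟨m, rfl⟩
          exact hall m)))
    rw [Polynomial.eval_mul, ← hP, ← hQ] at hm
    exact ⟨v ^ m, ⟨m, rfl⟩, hfO (left_ne_zero_of_mul hm), hgO (right_ne_zero_of_mul hm)⟩

/-- In a reductive group, closed normal unipotent subgroups are trivial. -/
theorem IsReductive.eq_bot_of_isUnipotent (hK : IsReductive K) {V : Subgroup K} (hn : V.Normal)
    (hc : IsClosed[zariskiTopology K] (V : Set K)) (hV : IsUnipotent V) : V = ⊥ := by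
  rw [eq_bot_iff, ← hK.unipotentRadical_eq_bot]
  exact le_sSup ⟨le_top, hn.subgroupOf ⊤, hc, isConnected_of_isUnipotent hV, hV⟩

/-- Unipotent elements act unipotently in algebraic representations. -/
theorem isNilpotent_rep_sub_one {F : Type*} [AddCommGroup F] [Module ℂ F] [FiniteDimensional ℂ F]
    {ρ : Representation ℂ K F} (hρ : IsAlgebraicRep ρ) {v : K}
    (hv : IsNilpotent (((v : GL (Fin n) ℂ) : Matrix (Fin n) (Fin n) ℂ) - 1)) :
    IsNilpotent (ρ v - 1) := by
  rw [Module.End.isNilpotent_iff_of_finite]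
  intro w
  let b := finBasis ℂ F
  choose P hP using fun i => exists_polynomial_apply_pow hv (matrixCoeff hρ (b.coord i) w)
  -- N exceeds the degree of every coordinate of k ↦ ρ(v)^k w, so the N-th finite difference at 0,
  -- which is (ρ(v) - 1)^N w, vanishes.
  let N := ∑ i, (P i).natDegree + 1
  refine ⟨N, b.ext_elem fun i => ?_⟩
  have hN : (P i).natDegree < N :=
    Nat.lt_succ_of_le (Finset.single_le_sum (f := fun i => (P i).natDegree)
      (fun _ _ => Nat.zero_le _) (Finset.mem_univ i))
  have h0 := congrFun (Polynomial.fwdDiff_iter_eq_zero_of_degree_lt hN) 0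
  rw [fwdDiff_iter_eq_sum_shift] at h0
  rw [map_zero, Finsupp.zero_apply, ← Basis.coord_apply]
  refine Eq.trans ?_ h0
  have h1 : (ρ v - 1) ^ N = ∑ k ∈ Finset.range (N + 1), ((-1 : ℤ) ^ (N - k) * N.choose k) •
      ρ v ^ k := by
    rw [sub_eq_add_neg, ((Commute.one_right (ρ v)).neg_right).add_pow]
    refine Finset.sum_congr rfl fun k _ => ?_
    rw [zsmul_eq_mul, mul_assoc]
    refine (Commute.eq ?_).trans ?_
    · exact ((Commute.neg_one_right _).pow_right _).mul_right (Nat.commute_cast _ _)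
    · push_cast
      rfl
  rw [h1, LinearMap.sum_apply, map_sum]
  refine Finset.sum_congr rfl fun k _ => ?_
  rw [LinearMap.smul_apply, map_zsmul, ← map_pow]
  have := hP i k
  rw [matrixCoeff_apply] at this
  rw [this]
  simp

/-! ### Kolchin's theorem -/

/-- For the rank one map b = l(·)e, the trace of ab is l(a e). -/
theorem eq_zero_of_forall_trace_mul_eq_zero {E : Type*} [AddCommGroup E] [Module ℂ E]
    [FiniteDimensional ℂ E] (a : End ℂ E) (h : ∀ b, LinearMap.trace ℂ E (a * b) = 0) : a = 0 := by
  ext e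
  refine (Module.forall_dual_apply_eq_zero_iff ℂ _).1 fun l => ?_
  have h1 := h (LinearMap.smulRight l e)
  have h2 : a * LinearMap.smulRight l e = LinearMap.smulRight l (a e) := by
    ext x
    simp
  rw [h2, LinearMap.trace_smulRight] at h1
  exact h1

/-- **Kolchin's theorem**: a monoid of unipotent endomorphisms has a nonzero fixed vector. -/
theorem exists_fixed_of_isNilpotent_sub_one {G : Type*} [Monoid G] (d : ℕ) :
    ∀ (E : Type*) [AddCommGroup E] [Module ℂ E] [FiniteDimensional ℂ E] [Nontrivial E],
      finrank ℂ E = d → ∀ τ : Representation ℂ G E, (∀ g, IsNilpotent (τ g - 1)) →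
      ∃ e : E, e ≠ 0 ∧ ∀ g, τ g e = e := by
  induction d using Nat.strong_induction_on with
  | _ d ih =>
  intro E _ _ _ _ hd τ hτ
  by_cases hW : ∃ W : Submodule ℂ E, W ≠ ⊥ ∧ W ≠ ⊤ ∧ ∀ g, ∀ w ∈ W, τ g w ∈ W
  · obtain ⟨W, hW0, hW1, hWs⟩ := hW
    have : Nontrivial W := Submodule.nontrivial_iff_ne_bot.2 hW0
    let τ' : Representation ℂ G W := Subrepresentation.toRepresentation ⟨W, hWs⟩
    have hτ' : ∀ g (w : W), (τ' g w : E) = τ g w := fun g w => rfl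
    obtain ⟨e, he, hfix⟩ := ih _ (hd ▸ Submodule.finrank_lt hW1) W rfl τ' (by
      intro g
      obtain ⟨N, hN⟩ := hτ g
      refine ⟨N, LinearMap.ext fun w => Subtype.ext ?_⟩
      have h1 : ∀ k : ℕ, ∀ w : W, (((τ' g - 1) ^ k) w : E) = ((τ g - 1) ^ k) (w : E) := by
        intro k
        induction k with
        | zero => intro w; rfl
        | succ k ihk =>
          intro w
          rw [pow_succ, pow_succ, Module.End.mul_apply, ihk]
          rfl
      rw [h1, hN]
      rfl)
    exact ⟨e, by simpa using he, fun g => congrArg Subtype.val (hfix g)⟩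
  · push Not at hW
    let S : Subalgebra ℂ (End ℂ E) := Algebra.adjoin ℂ (Set.range τ)
    have hS : IsSimpleModule S E := by
      rw [isSimpleModule_iff]
      refine { eq_bot_or_eq_top := fun N => ?_ }
      by_contra! hN
      obtain ⟨g, w, hw, hgw⟩ := hW (N.restrictScalars ℂ) (by simpa using hN.1) (by simpa using hN.2)
      exact hgw (N.smul_mem (⟨τ g, Algebra.subset_adjoin ⟨g, rfl⟩⟩ : S) hw)
    -- The image of τ spans S, and all its elements have the trace of the identity.
    have htr : ∀ g, ∀ a ∈ S, LinearMap.trace ℂ E ((τ g - 1) * a) = 0 := by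
      intro g a ha
      have h0 : ∀ g, LinearMap.trace ℂ E (τ g) = LinearMap.trace ℂ E 1 := fun g => by
        rw [← sub_eq_zero, ← map_sub]
        exact (LinearMap.isNilpotent_trace_of_isNilpotent (hτ g)).eq_zero
      rw [← Subalgebra.mem_toSubmodule, Algebra.adjoin_eq_span] at ha
      have hcl : (Submonoid.closure (Set.range τ) : Set (End ℂ E)) = Set.range τ := by
        have : Submonoid.closure (Set.range τ) = MonoidHom.mrange τ := by
          rw [← MonoidHom.coe_mrange, Submonoid.closure_eq]
        rw [this, MonoidHom.coe_mrange]
      rw [hcl] at ha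
      induction ha using Submodule.span_induction with
      | mem a ha =>
        obtain ⟨h, rfl⟩ := ha
        rw [sub_mul, one_mul, ← map_mul, map_sub, h0, h0, sub_self]
      | zero => rw [mul_zero, map_zero]
      | add a b _ _ ha hb => rw [mul_add, map_add, ha, hb, add_zero]
      | smul c a _ ha => rw [mul_smul_comm, map_smul, ha, smul_zero]
    -- Burnside's theorem: by Schur's lemma the S-endomorphisms are scalars, and Jacobson density
    -- realizes f on a basis.
    have hdens : ∀ f : End ℂ E, f ∈ S := by
      intro f
      have hbij := IsSimpleModule.algebraMap_end_bijective_of_isAlgClosed (A := S) (V := E) ℂ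
      let f' : End (End S E) E :=
        { toFun := f
          map_add' := map_add f
          map_smul' := fun c e => by
            obtain ⟨c, rfl⟩ := hbij.2 c
            simp }
      classical
      obtain ⟨r, hr⟩ := jacobson_density f' (Finset.univ.image (finBasis ℂ E))
      have : f = r := (finBasis ℂ E).ext fun i => hr _ (by simp)
      rw [this]
      exact r.2
    obtain ⟨e, he⟩ := exists_ne (0 : E)
    refine ⟨e, he, fun g => ?_⟩
    have := eq_zero_of_forall_trace_mul_eq_zero (τ g - 1) fun b => htr g b (hdens b)
    rw [sub_eq_zero.1 this]
    rfl

/-! ### The action of the unipotent radical -/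

section Rep

variable {F : Type*} [AddCommGroup F] [Module ℂ F] {ρ : Representation ℂ K F}
  [FiniteDimensional ℂ F]

/-- Every subgroup `H` has a nonzero stable subspace on which its unipotent radical acts
trivially. -/
theorem exists_stable_fixed_unipotentRadical [Nontrivial F] (hρ : IsAlgebraicRep ρ)
    (H : Subgroup K) : ∃ W : Submodule ℂ F, W ≠ ⊥ ∧ (∀ h ∈ H, ∀ w ∈ W, ρ h w ∈ W) ∧
      ∀ u ∈ unipotentRadical H, ∀ w ∈ W, ρ u w = w := by
  have hex : ∃ d : ℕ, ∃ W : Submodule ℂ F, W ≠ ⊥ ∧ (∀ h ∈ H, ∀ w ∈ W, ρ h w ∈ W) ∧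
      finrank ℂ W = d := ⟨_, ⊤, top_ne_bot, fun _ _ _ _ => Submodule.mem_top, rfl⟩
  classical
  obtain ⟨W, hW0, hWs, hWd⟩ := Nat.find_spec hex
  have hmin : ∀ W' : Submodule ℂ F, W' ≤ W → W' ≠ ⊥ → (∀ h ∈ H, ∀ w ∈ W', ρ h w ∈ W') →
      W' = W := by
    intro W' hle h0 hs
    refine Submodule.eq_of_le_of_finrank_le hle ?_
    rw [hWd]
    exact Nat.find_min' hex ⟨W', h0, hs, rfl⟩
  refine ⟨W, hW0, hWs, ?_⟩
  let T : Subgroup K :=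
    { carrier := {u | ∀ w ∈ W, ρ u w = w}
      one_mem' := fun w _ => by rw [map_one]; rfl
      mul_mem' := fun {x y} hx hy w hw => by
        rw [map_mul, Module.End.mul_apply, hy w hw, hx w hw]
      inv_mem' := fun {x} hx w hw => by
        conv_lhs => rw [← hx w hw]
        simp }
  suffices unipotentRadical H ≤ T from fun u hu => this hu
  refine sSup_le ?_
  rintro V ⟨hVH, hVn, -, -, hVu⟩
  have hconj : ∀ h ∈ H, ∀ v ∈ V, h⁻¹ * v * h ∈ V := by
    intro h hh v hv
    have := hVn.conj_mem ⟨v, hVH hv⟩ hv (⟨h, hh⟩⁻¹)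
    simpa [Subgroup.mem_subgroupOf] using this
  -- The V-fixed vectors of W are H-stable because V is normal in H, and nonzero by Kolchin's
  -- theorem, so minimality makes them all of W.
  let W' : Submodule ℂ F :=
    { carrier := {w | w ∈ W ∧ ∀ v ∈ V, ρ v w = w}
      add_mem' := fun {a b} ha hb =>
        ⟨add_mem ha.1 hb.1, fun v hv => by rw [map_add, ha.2 v hv, hb.2 v hv]⟩
      zero_mem' := ⟨zero_mem _, fun v _ => map_zero _⟩
      smul_mem' := fun c a ha =>
        ⟨W.smul_mem c ha.1, fun v hv => by rw [map_smul, ha.2 v hv]⟩ }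
  have hW' : W' = W := by
    refine hmin W' (fun w hw => hw.1) ?_ ?_
    · have : Nontrivial W := Submodule.nontrivial_iff_ne_bot.2 hW0
      let τ : Representation ℂ V W :=
        Subrepresentation.toRepresentation (ρ := (ρ.comp V.subtype : Representation ℂ V F))
          ⟨W, fun v w hw => hWs v (hVH v.2) w hw⟩
      obtain ⟨e, he, hfix⟩ := exists_fixed_of_isNilpotent_sub_one _ W rfl τ (by
        intro v
        obtain ⟨N, hN⟩ := isNilpotent_rep_sub_one hρ (hVu v v.2)
        refine ⟨N, LinearMap.ext fun w => Subtype.ext ?_⟩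
        have h1 : ∀ k : ℕ, ∀ w : W, (((τ v - 1) ^ k) w : F) = ((ρ (v : K) - 1) ^ k) (w : F) := by
          intro k
          induction k with
          | zero => intro w; rfl
          | succ k ihk =>
            intro w
            rw [pow_succ, pow_succ, Module.End.mul_apply, ihk]
            rfl
        rw [h1, hN]
        rfl)
      refine (Submodule.ne_bot_iff _).2 ⟨e, ⟨e.2, fun v hv => ?_⟩, by simpa using he⟩
      exact congrArg Subtype.val (hfix ⟨v, hv⟩)
    · intro h hh w hw
      refine ⟨hWs h hh w hw.1, fun v hv => ?_⟩
      have e : v * h = h * (h⁻¹ * v * h) := by group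
      rw [← Module.End.mul_apply, ← map_mul, e, map_mul, Module.End.mul_apply,
        hw.2 _ (hconj h hh v hv)]
  intro v hv w hw
  rw [← hW'] at hw
  exact hw.2 v hv

end Rep

end LinAlgGrp

namespace LinAlgGrp

open Module

/-! ### Replicas -/

section LinearAlgebra

variable {V : Type*} [AddCommGroup V] [Module ℂ V]

/-- A linear map which acts by prescribed scalars on the generalized eigenspaces. -/
theorem exists_smul_on_maxGenEigenspace (X : End ℂ V) (hX : ⨆ a, X.maxGenEigenspace a = ⊤)
    (c : ℂ → ℂ) : ∃ Y : End ℂ V, ∀ a, ∀ v ∈ X.maxGenEigenspace a, Y v = c a • v := by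
  classical
  have hint := DirectSum.isInternal_submodule_of_iSupIndep_of_iSup_eq_top
    X.independent_maxGenEigenspace hX
  let e := LinearEquiv.ofBijective (DirectSum.coeLinearMap fun a => X.maxGenEigenspace a) hint
  refine ⟨(DirectSum.toModule ℂ ℂ V fun a => c a • (X.maxGenEigenspace a).subtype) ∘ₗ
    e.symm.toLinearMap, fun a v hv => ?_⟩
  have he : e.symm v = DirectSum.lof ℂ ℂ (fun a => X.maxGenEigenspace a) a ⟨v, hv⟩ := by
    rw [LinearEquiv.symm_apply_eq]
    exact (DirectSum.coeLinearMap_lof _ a ⟨v, hv⟩).symm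
  rw [LinearMap.comp_apply, LinearEquiv.coe_coe, he, DirectSum.toModule_lof]
  rfl

theorem map_mem_maxGenEigenspace {W : Type*} [AddCommGroup W] [Module ℂ W] {X : End ℂ V}
    {X' : End ℂ W} (T : W →ₗ[ℂ] V) (hT : ∀ w, X (T w) = T (X' w)) {a : ℂ} {w : W}
    (hw : w ∈ X'.maxGenEigenspace a) : T w ∈ X.maxGenEigenspace a := by
  rw [End.mem_maxGenEigenspace] at hw ⊢
  obtain ⟨k, hk⟩ := hw
  refine ⟨k, ?_⟩
  have h : ∀ k w, ((X - a • (1 : End ℂ V)) ^ k) (T w) = T (((X' - a • (1 : End ℂ W)) ^ k) w) := by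
    intro k
    induction k with
    | zero => intro w; rfl
    | succ k ih =>
      intro w
      rw [pow_succ, pow_succ, Module.End.mul_apply, Module.End.mul_apply, ← ih]
      congr 1
      simp [hT]
  rw [h, hk, map_zero]

theorem map_mem_iSup_maxGenEigenspace {W : Type*} [AddCommGroup W] [Module ℂ W]
    [FiniteDimensional ℂ W] {X : End ℂ V} {X' : End ℂ W} (T : W →ₗ[ℂ] V)
    (hT : ∀ w, X (T w) = T (X' w)) (w : W) : T w ∈ ⨆ a, X.maxGenEigenspace a := by
  have hw : w ∈ ⨆ a, X'.maxGenEigenspace a := by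
    rw [End.iSup_maxGenEigenspace_eq_top]
    exact Submodule.mem_top
  induction hw using Submodule.iSup_induction' with
  | mem a w hw => exact Submodule.mem_iSup_of_mem a (map_mem_maxGenEigenspace T hT hw)
  | zero => rw [map_zero]; exact zero_mem _
  | add v w _ _ hv hw => rw [map_add]; exact add_mem hv hw

/-- The trace of the composition with a map which is scalar on the generalized eigenspaces. -/
theorem trace_mul_eq_sum [FiniteDimensional ℂ V] (X Y : End ℂ V) (c : ℂ → ℂ)
    (hY : ∀ a, ∀ v ∈ X.maxGenEigenspace a, Y v = c a • v)
    (hfin : {a | X.maxGenEigenspace a ≠ ⊥}.Finite) :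
    LinearMap.trace ℂ V (X * Y) =
      ∑ a ∈ hfin.toFinset, c a * (a * (finrank ℂ (X.maxGenEigenspace a) : ℂ)) := by
  classical
  have hint := DirectSum.isInternal_submodule_of_iSupIndep_of_iSup_eq_top
    X.independent_maxGenEigenspace (End.iSup_maxGenEigenspace_eq_top X)
  have hX : ∀ a, Set.MapsTo X (X.maxGenEigenspace a) (X.maxGenEigenspace a) := fun a =>
    End.mapsTo_maxGenEigenspace_of_comm (Commute.refl X) a
  have hXY : ∀ a, Set.MapsTo (X * Y) (X.maxGenEigenspace a) (X.maxGenEigenspace a) := by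
    intro a v hv
    rw [Module.End.mul_apply, hY a v hv, map_smul]
    exact Submodule.smul_mem _ _ (hX a hv)
  rw [LinearMap.trace_eq_sum_trace_restrict' hint hfin hXY]
  refine Finset.sum_congr rfl fun a _ => ?_
  have h1 : (X * Y).restrict (hXY a) = c a • X.restrict (hX a) := by
    ext ⟨v, hv⟩
    change X (Y v) = c a • X v
    rw [hY a v hv, map_smul]
  have h2 := LinearMap.trace_comp_eq_mul_of_commute_of_isNilpotent a
    (Commute.one_left (X.restrict (hX a))) (End.isNilpotent_restrict_maxGenEigenspace_sub_algebraMap X a)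
  rw [h1, map_smul, smul_eq_mul]
  congr 1
  have h3 : (1 : End ℂ (X.maxGenEigenspace a)) ∘ₗ X.restrict (hX a) = X.restrict (hX a) := rfl
  rw [h3, LinearMap.trace_one] at h2
  exact h2

/-- The trace of XY is a sum of m_a g(a) a over the eigenvalues a with multiplicities m_a. Applying
g turns its vanishing into that of a sum of nonnegative rationals m_a g(a)². Hence each g kills each
eigenvalue, and rational functionals separate points of ℂ. -/
theorem isNilpotent_of_trace_additive [FiniteDimensional ℂ V] (X : End ℂ V)
    (h : ∀ g : ℂ →ₗ[ℚ] ℚ, ∃ Y : End ℂ V,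
      (∀ a, ∀ v ∈ X.maxGenEigenspace a, Y v = (g a : ℂ) • v) ∧ LinearMap.trace ℂ V (X * Y) = 0) :
    IsNilpotent X := by
  have hfin : {a | X.maxGenEigenspace a ≠ ⊥}.Finite :=
    WellFoundedGT.finite_ne_bot_of_iSupIndep X.independent_maxGenEigenspace
  have hzero : ∀ a, X.maxGenEigenspace a ≠ ⊥ → a = 0 := by
    intro a ha
    refine (Module.forall_dual_apply_eq_zero_iff ℚ a).1 fun g => ?_
    obtain ⟨Y, hY, htr⟩ := h g
    rw [trace_mul_eq_sum X Y _ hY hfin] at htr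
    have h1 := congrArg g htr
    rw [map_sum, map_zero] at h1
    have h2 : ∀ a : ℂ, g ((g a : ℂ) * (a * (finrank ℂ (X.maxGenEigenspace a) : ℂ))) =
        finrank ℂ (X.maxGenEigenspace a) * (g a * g a) := by
      intro a
      have e : (g a : ℂ) * (a * (finrank ℂ (X.maxGenEigenspace a) : ℂ)) =
          (g a * (finrank ℂ (X.maxGenEigenspace a) : ℚ) : ℚ) • a := by
        rw [Rat.smul_def]
        push_cast
        ring
      rw [e, map_smul, smul_eq_mul]
      ring
    simp only [h2] at h1
    have h3 := (Finset.sum_eq_zero_iff_of_nonneg (fun b _ =>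
      mul_nonneg (Nat.cast_nonneg _) (mul_self_nonneg (g b)))).1 h1 a (hfin.mem_toFinset.2 ha)
    have h4 : (finrank ℂ (X.maxGenEigenspace a) : ℚ) ≠ 0 := by
      rw [Nat.cast_ne_zero]
      exact fun h0 => ha (Submodule.finrank_eq_zero.1 h0)
    exact mul_self_eq_zero.1 ((mul_eq_zero.1 h3).resolve_left h4)
  have htop : X.maxGenEigenspace 0 = ⊤ := by
    rw [eq_top_iff, ← End.iSup_maxGenEigenspace_eq_top X]
    refine iSup_le fun a => ?_
    by_cases ha : X.maxGenEigenspace a = ⊥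
    · rw [ha]; exact bot_le
    · rw [hzero a ha]
  rw [Module.End.isNilpotent_iff_of_finite]
  intro v
  have hv : v ∈ X.maxGenEigenspace 0 := htop ▸ Submodule.mem_top
  rw [End.mem_maxGenEigenspace] at hv
  simpa using hv

end LinearAlgebra

section Derivation

variable {A : Type*} [CommRing A] [Algebra ℂ A] (D : Derivation ℂ A A)

/-- A derivation as a linear endomorphism. -/
abbrev derivEnd : End ℂ A := D.toLinearMap

/-- The operator D - (a + b) obeys a Leibniz rule with D - a on the first factor and D - b on the
second. -/
theorem mul_mem_maxGenEigenspace {a b : ℂ} {f g : A}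
    (hf : f ∈ (derivEnd D).maxGenEigenspace a) (hg : g ∈ (derivEnd D).maxGenEigenspace b) :
    f * g ∈ (derivEnd D).maxGenEigenspace (a + b) := by
  rw [End.mem_maxGenEigenspace] at hf hg ⊢
  obtain ⟨k, hk⟩ := hf
  obtain ⟨l, hl⟩ := hg
  refine ⟨k + l, ?_⟩
  have key : ∀ N k l : ℕ, k + l = N → ∀ f g : A,
      ((derivEnd D - a • (1 : End ℂ A)) ^ k) f = 0 →
      ((derivEnd D - b • (1 : End ℂ A)) ^ l) g = 0 →
      ((derivEnd D - (a + b) • (1 : End ℂ A)) ^ N) (f * g) = 0 := by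
    intro N
    induction N with
    | zero =>
      intro k l hN f g hf _
      obtain rfl : k = 0 := by omega
      rw [show f = 0 from hf, zero_mul, map_zero]
    | succ N ih =>
      intro k l hN f g hf hg
      rcases k with _ | k
      · rw [show f = 0 from hf, zero_mul, map_zero]
      rcases l with _ | l
      · rw [show g = 0 from hg, mul_zero, map_zero]
      have e : (derivEnd D - (a + b) • (1 : End ℂ A)) (f * g) =
          ((derivEnd D - a • (1 : End ℂ A)) f) * g +
            f * ((derivEnd D - b • (1 : End ℂ A)) g) := by
        simp only [LinearMap.sub_apply, LinearMap.smul_apply, Module.End.one_apply,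
          Derivation.coeFn_coe, Derivation.leibniz, smul_eq_mul]
        simp only [Algebra.smul_def, map_add]
        ring
      rw [pow_succ, Module.End.mul_apply, e, map_add]
      rw [ih k (l + 1) (by omega) _ g (by rw [← Module.End.mul_apply, ← pow_succ]; exact hf) hg,
        ih (k + 1) l (by omega) f _ hf (by rw [← Module.End.mul_apply, ← pow_succ]; exact hg),
        add_zero]
  exact key _ k l rfl f g hk hl

/-- A linear map which acts by additive scalars on the generalized eigenspaces of a derivation is
a derivation. -/
theorem leibniz_of_smul_on_maxGenEigenspace
    (hD : ⨆ a, (derivEnd D).maxGenEigenspace a = ⊤) (c : ℂ → ℂ)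
    (hc : ∀ a b, c (a + b) = c a + c b) (Y : End ℂ A)
    (hY : ∀ a, ∀ f ∈ (derivEnd D).maxGenEigenspace a, Y f = c a • f) (f g : A) :
    Y (f * g) = f • Y g + g • Y f := by
  have hf : f ∈ ⨆ a, (derivEnd D).maxGenEigenspace a := hD ▸ Submodule.mem_top
  have hg : g ∈ ⨆ a, (derivEnd D).maxGenEigenspace a := hD ▸ Submodule.mem_top
  induction hf using Submodule.iSup_induction' with
  | mem a f hf =>
    induction hg using Submodule.iSup_induction' with
    | mem b g hg =>
      rw [hY _ _ (mul_mem_maxGenEigenspace D hf hg), hY a f hf, hY b g hg, hc]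
      simp only [smul_eq_mul, Algebra.smul_def, map_add]
      ring
    | zero => simp
    | add g h _ _ hg hh =>
      rw [mul_add, map_add, map_add, hg, hh]
      simp only [smul_eq_mul]
      ring
  | zero => simp
  | add f h _ _ hf hh =>
    rw [add_mul, map_add, map_add, hf, hh]
    simp only [smul_eq_mul]
    ring

end Derivation

attribute [local instance] LieRing.ofAssociativeRing

variable {n : ℕ} {K : Subgroup (GL (Fin n) ℂ)}

/-- D preserves the finite-dimensional span of each row of x and of each column of x⁻¹; products are
covered by additivity of generalized eigenvalues. -/
theorem iSup_maxGenEigenspace_lieAlg (D : lieAlg K) :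
    ⨆ a, (derivEnd (D : Derivation ℂ (coordRing K) (coordRing K))).maxGenEigenspace a = ⊤ := by
  rw [Submodule.eq_top_iff']
  intro f
  induction f using coordRing_induction with
  | entry i j =>
    let T : (Fin n → ℂ) →ₗ[ℂ] coordRing K := matrixCoeffHom (isAlgebraicRep_stdRep K) (LinearMap.proj i)
    have := map_mem_iSup_maxGenEigenspace
      (X := derivEnd (D : Derivation ℂ (coordRing K) (coordRing K)))
      (X' := stdDifferential K D) T
      (fun w => lieAlg_matrixCoeff (isAlgebraicRep_stdRep K) D _ w) (Pi.single j 1)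
    rwa [matrixCoeffHom_apply, matrixCoeff_stdRep] at this
  | inv i j =>
    let T : (Fin n → ℂ) →ₗ[ℂ] coordRing K :=
      Fintype.linearCombination ℂ (fun k => invEntryCoord k j)
    have := map_mem_iSup_maxGenEigenspace
      (X := derivEnd (D : Derivation ℂ (coordRing K) (coordRing K)))
      (X' := - Matrix.toLin' (lieMatrix D).transpose) T
      (fun w => by
        simp only [T, Fintype.linearCombination_apply, map_sum, map_smul, Derivation.coeFn_coe,
          lieAlg_invEntryCoord, LinearMap.neg_apply, Matrix.toLin'_apply, Pi.neg_apply, neg_smul,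
          smul_neg, Finset.sum_neg_distrib, Finset.smul_sum, Matrix.mulVec, dotProduct,
          Finset.sum_smul, Matrix.transpose_apply]
        rw [Finset.sum_comm]
        congr 1
        refine Finset.sum_congr rfl fun k _ => Finset.sum_congr rfl fun m _ => ?_
        rw [smul_smul, mul_comm]) (Pi.single i 1)
    simpa [T, Fintype.linearCombination_apply] using this
  | const r =>
    refine Submodule.mem_iSup_of_mem 0 ?_
    rw [End.mem_maxGenEigenspace]
    exact ⟨1, by simp⟩
  | add f g hf hg => exact add_mem hf hg
  | mul f g hf hg =>
    induction hf using Submodule.iSup_induction' with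
    | mem a f hf =>
      induction hg using Submodule.iSup_induction' with
      | mem b g hg => exact Submodule.mem_iSup_of_mem _ (mul_mem_maxGenEigenspace _ hf hg)
      | zero => rw [mul_zero]; exact zero_mem _
      | add g h _ _ hg hh => rw [mul_add]; exact add_mem hg hh
    | zero => rw [zero_mul]; exact zero_mem _
    | add f h _ _ hf hh => rw [add_mul]; exact add_mem hf hh

/-- The Lie algebra of `K` contains the replicas of its elements. -/
theorem exists_replica (D : lieAlg K) (c : ℂ → ℂ) (hc : ∀ a b, c (a + b) = c a + c b) :
    ∃ E : lieAlg K, ∀ a, ∀ v ∈ (stdDifferential K D).maxGenEigenspace a,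
      stdDifferential K E v = c a • v := by
  obtain ⟨Y, hY⟩ := exists_smul_on_maxGenEigenspace _ (iSup_maxGenEigenspace_lieAlg D) c
  let E : Derivation ℂ (coordRing K) (coordRing K) := Derivation.mk' Y
    (leibniz_of_smul_on_maxGenEigenspace _ (iSup_maxGenEigenspace_lieAlg D) c hc Y hY)
  have hE : E ∈ lieAlg K := by
    intro x f
    change Y (leftPullback x f) = leftPullback x (Y f)
    have hf : f ∈ ⨆ a, (derivEnd (D : Derivation ℂ (coordRing K) (coordRing K))).maxGenEigenspace a :=
      iSup_maxGenEigenspace_lieAlg D ▸ Submodule.mem_top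
    induction hf using Submodule.iSup_induction' with
    | mem a f hf =>
      rw [hY a f hf, map_smul]
      exact hY a _ (map_mem_maxGenEigenspace (leftPullback x).toLinearMap (D.2 x) hf)
    | zero => simp
    | add f g _ _ hf hg => rw [map_add, map_add, map_add, map_add, hf, hg]
  refine ⟨⟨E, hE⟩, fun a v hv => eq_of_forall_dual fun l => ?_⟩
  -- The coefficient map intertwines the matrix of D with D itself, so Y scales the coefficient of v
  -- by c(a); evaluation at 1 transfers this to v.
  have h := hY a _ (map_mem_maxGenEigenspace (matrixCoeffHom (isAlgebraicRep_stdRep K) l)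
    (fun w => lieAlg_matrixCoeff (isAlgebraicRep_stdRep K) D l w) hv)
  have h1 := dual_repDifferential (isAlgebraicRep_stdRep K) ⟨E, hE⟩ l v
  refine h1.trans ?_
  change (Y (matrixCoeff _ l v) : K → ℂ) 1 = _
  rw [matrixCoeffHom_apply] at h
  rw [h, map_smul]
  change c a * l (stdRep K 1 v) = _
  rw [map_one]
  rfl

/-- An element of the Lie algebra which is orthogonal to the Lie algebra for the trace form is
nilpotent. -/
theorem isNilpotent_of_trace_eq_zero (D : lieAlg K)
    (h : ∀ E : lieAlg K, LinearMap.trace ℂ _ (stdDifferential K D * stdDifferential K E) = 0) :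
    IsNilpotent (stdDifferential K D) := by
  refine isNilpotent_of_trace_additive _ fun g => ?_
  obtain ⟨E, hE⟩ := exists_replica D (fun a => (g a : ℂ)) (fun a b => by rw [map_add]; push_cast; rfl)
  exact ⟨_, hE, h E⟩

end LinAlgGrp

/-! ### Nondegeneracy of the trace form of a reductive group -/

namespace LinAlgGrp

open Module

attribute [local instance] LieRing.ofAssociativeRing

variable {n : ℕ} {K : Subgroup (GL (Fin n) ℂ)}

variable (K) in
/-- The kernel of the trace form of the tautological representation. -/
def traceRadical : LieIdeal ℂ (lieAlg K) where
  carrier := {D | ∀ E : lieAlg K,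
    LinearMap.trace ℂ _ (stdDifferential K D * stdDifferential K E) = 0}
  zero_mem' := fun E => by rw [map_zero, zero_mul, map_zero]
  add_mem' := fun {D D'} hD hD' E => by rw [map_add, add_mul, map_add, hD, hD', add_zero]
  smul_mem' := fun c D hD E => by rw [map_smul, smul_mul_assoc, map_smul, hD, smul_zero]
  lie_mem := fun {x D} hD E => by
    have h := hD ⁅E, x⁆
    rw [LieHom.map_lie, LieRing.of_associative_ring_bracket, mul_sub, map_sub, ← mul_assoc,
      LinearMap.trace_mul_comm, ← mul_assoc, ← mul_assoc] at h
    rwa [LieHom.map_lie, LieRing.of_associative_ring_bracket, sub_mul, map_sub]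

theorem stdDifferential_Ad (x : K) (D : lieAlg K) : stdDifferential K (Ad x D) =
    stdRep K x * stdDifferential K D * stdRep K x⁻¹ :=
  LinearMap.ext fun v => repDifferential_Ad (isAlgebraicRep_stdRep K) x D v

theorem Ad_mem_traceRadical (x : K) {D : lieAlg K} (hD : D ∈ traceRadical K) :
    Ad x D ∈ traceRadical K := by
  intro E
  have h := hD (Ad x⁻¹ E)
  rw [stdDifferential_Ad, inv_inv] at h
  rw [stdDifferential_Ad, mul_assoc, mul_assoc, LinearMap.trace_mul_comm]
  simpa only [mul_assoc] using h

variable (K) in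
/-- The flag of subspaces generated by the kernel of the trace form. -/
def traceFlag : ℕ → Submodule ℂ (Fin n → ℂ)
  | 0 => ⊤
  | k + 1 => ⨆ D : traceRadical K, (traceFlag k).map (stdDifferential K D)

theorem apply_mem_traceFlag {D : lieAlg K} (hD : D ∈ traceRadical K) {k : ℕ} {v : Fin n → ℂ}
    (hv : v ∈ traceFlag K k) : stdDifferential K D v ∈ traceFlag K (k + 1) :=
  Submodule.mem_iSup_of_mem (p := fun D : traceRadical K => (traceFlag K k).map (stdDifferential K D))
    ⟨D, hD⟩ (Submodule.mem_map_of_mem hv)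

theorem traceFlag_succ_le (k : ℕ) : traceFlag K (k + 1) ≤ traceFlag K k := by
  induction k with
  | zero => exact le_top
  | succ k ih => exact iSup_mono fun D => Submodule.map_mono ih

theorem pow_apply_mem_traceFlag {D : lieAlg K} (hD : D ∈ traceRadical K) {k : ℕ} {v : Fin n → ℂ}
    (hv : v ∈ traceFlag K k) (m : ℕ) :
    (stdDifferential K D ^ (m + 1)) v ∈ traceFlag K (k + 1) := by
  induction m with
  | zero => rw [zero_add, pow_one]; exact apply_mem_traceFlag hD hv
  | succ m ih =>
    rw [pow_succ', Module.End.mul_apply]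
    exact traceFlag_succ_le _ (apply_mem_traceFlag hD ih)

/-- The kernel of the trace form is Ad-stable, and moving x past D replaces D by Ad(x)D. -/
theorem stdRep_mem_traceFlag (x : K) {k : ℕ} {v : Fin n → ℂ} (hv : v ∈ traceFlag K k) :
    stdRep K x v ∈ traceFlag K k := by
  induction k generalizing v with
  | zero => exact Submodule.mem_top
  | succ k ih =>
    induction hv using Submodule.iSup_induction' with
    | mem D w hw =>
      obtain ⟨v, hv, rfl⟩ := hw
      have h : stdRep K x (stdDifferential K D v) = stdDifferential K (Ad x D) (stdRep K x v) := by
        rw [stdDifferential_Ad, Module.End.mul_apply, Module.End.mul_apply,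
          ← Module.End.mul_apply (stdRep K x⁻¹), ← map_mul, inv_mul_cancel, map_one]
        rfl
      rw [h]
      exact apply_mem_traceFlag (Ad_mem_traceRadical x D.2) (ih hv)
    | zero => rw [map_zero]; exact zero_mem _
    | add v w _ _ hv hw => rw [map_add]; exact add_mem hv hw

variable (K) in
/-- The tautological module of the Lie algebra of a linear group. -/
@[reducible] def stdLieRingModule : LieRingModule (lieAlg K) (Fin n → ℂ) :=
  LieRingModule.compLieHom (Fin n → ℂ) (stdDifferential K)

attribute [local instance] stdLieRingModule

variable (K) in
theorem stdLieModule : LieModule ℂ (lieAlg K) (Fin n → ℂ) :=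
  LieModule.compLieHom (Fin n → ℂ) (stdDifferential K)

attribute [local instance] stdLieModule

-- Engel's theorem applies because replicas make every element of the kernel nilpotent; the flag
-- lies inside the resulting lower central series.
variable (K) in
theorem exists_traceFlag_eq_bot : ∃ k, traceFlag K k = ⊥ := by
  have hnil : LieModule.IsNilpotent (traceRadical K) (Fin n → ℂ) := by
    rw [LieModule.isNilpotent_iff_forall (R := ℂ)]
    intro D
    exact isNilpotent_of_trace_eq_zero (D : lieAlg K) D.2
  obtain ⟨k, hk⟩ := (LieModule.isNilpotent_iff ℂ (traceRadical K) (Fin n → ℂ)).1 hnil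
  refine ⟨k, ?_⟩
  have h : ∀ k, traceFlag K k ≤
      (LieModule.lowerCentralSeries ℂ (traceRadical K) (Fin n → ℂ) k).toSubmodule := by
    intro k
    induction k with
    | zero => exact le_top
    | succ k ih =>
      refine iSup_le fun D => ?_
      rintro _ ⟨v, hv, rfl⟩
      rw [LieModule.lowerCentralSeries_succ]
      exact LieSubmodule.lie_mem_lie (LieSubmodule.mem_top D) (ih hv)
  have h1 := h k
  rw [hk] at h1
  exact eq_bot_iff.2 h1

variable (K) in
/-- The elements of `K` which act trivially on the quotients of the flag. -/
def traceFlagFixer : Subgroup K where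
  carrier := {x | ∀ k, ∀ v ∈ traceFlag K k, stdRep K x v - v ∈ traceFlag K (k + 1)}
  one_mem' := fun k v _ => by
    rw [map_one, Module.End.one_apply, sub_self]
    exact zero_mem _
  mul_mem' := fun {x y} hx hy k v hv => by
    have e : stdRep K (x * y) v - v = stdRep K x (stdRep K y v - v) + (stdRep K x v - v) := by
      rw [map_mul, Module.End.mul_apply, map_sub]; abel
    rw [e]
    exact add_mem (stdRep_mem_traceFlag x (hy k v hv)) (hx k v hv)
  inv_mem' := fun {x} hx k v hv => by
    have e : stdRep K x⁻¹ v - v = - stdRep K x⁻¹ (stdRep K x v - v) := by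
      rw [map_sub, ← Module.End.mul_apply, ← map_mul, inv_mul_cancel, map_one,
        Module.End.one_apply, neg_sub]
    rw [e]
    exact neg_mem (stdRep_mem_traceFlag x⁻¹ (hx k v hv))

variable (K) in
/-- The regular functions which cut out the fixer of the flag. -/
def traceFlagEquations : Set (coordRing K) :=
  {f | ∃ k, ∃ v ∈ traceFlag K k, ∃ l ∈ (traceFlag K (k + 1)).dualAnnihilator,
    f = matrixCoeff (isAlgebraicRep_stdRep K) l v - algebraMap ℂ _ (l v)}

theorem mem_traceFlagFixer_iff {x : K} :
    x ∈ traceFlagFixer K ↔ ∀ f ∈ traceFlagEquations K, (f : K → ℂ) x = 0 := by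
  constructor
  · rintro hx _ ⟨k, v, hv, l, hl, rfl⟩
    have := (Submodule.mem_dualAnnihilator l).1 hl _ (hx k v hv)
    rwa [map_sub] at this
  · intro h k v hv
    rw [← Subspace.dualAnnihilator_dualCoannihilator_eq (W := traceFlag K (k + 1)),
      Submodule.mem_dualCoannihilator]
    intro l hl
    rw [map_sub]
    exact h _ ⟨k, v, hv, l, hl, rfl⟩

theorem isClosed_traceFlagFixer : IsClosed[zariskiTopology K] (traceFlagFixer K : Set K) := by
  let _ := zariskiTopology K
  have h : (traceFlagFixer K : Set K) =
      ⋂ f ∈ traceFlagEquations K, {x : K | (f : K → ℂ) x ≠ 0}ᶜ := by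
    ext x
    simp only [SetLike.mem_coe, mem_traceFlagFixer_iff, Set.mem_iInter, Set.mem_compl_iff,
      Set.mem_ofPred_eq, not_not]
  rw [h]
  exact isClosed_biInter fun f _ => (isOpen_ne_zero f).isClosed_compl

theorem traceFlagFixer_normal : (traceFlagFixer K).Normal := by
  refine ⟨fun x hx g k v hv => ?_⟩
  have e : stdRep K (g * x * g⁻¹) v - v =
      stdRep K g (stdRep K x (stdRep K g⁻¹ v) - stdRep K g⁻¹ v) := by
    rw [map_sub, ← Module.End.mul_apply (stdRep K g) (stdRep K g⁻¹), ← map_mul, mul_inv_cancel, map_one,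
      Module.End.one_apply, map_mul, map_mul]
    rfl
  rw [e]
  exact stdRep_mem_traceFlag g (hx k _ (stdRep_mem_traceFlag g⁻¹ hv))

theorem isUnipotent_traceFlagFixer : IsUnipotent (traceFlagFixer K) := by
  intro x hx
  obtain ⟨N, hN⟩ := exists_traceFlag_eq_bot K
  have h : ∀ k v, ((stdRep K x - 1) ^ k) v ∈ traceFlag K k := by
    intro k
    induction k with
    | zero => exact fun v => Submodule.mem_top
    | succ k ih =>
      intro v
      rw [pow_succ', Module.End.mul_apply]
      exact hx k _ (ih v)
  have h1 : (stdRep K x - 1) ^ N = 0 := by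
    ext1 v
    have := h N (LinearMap.single ℂ _ v 1)
    rw [hN, Submodule.mem_bot] at this
    refine LinearMap.ext_ring ?_
    exact this
  refine ⟨N, ?_⟩
  apply (Matrix.toLinAlgEquiv' (R := ℂ) (n := Fin n)).injective
  rw [map_pow, map_sub, map_one, map_zero]
  exact h1

/-- The trace form of the tautological representation of a reductive group is nondegenerate. -/
theorem IsReductive.traceForm_nondegenerate (hK : IsReductive K) (D : lieAlg K)
    (hD : ∀ E, LieModule.traceForm ℂ (lieAlg K) (Fin n → ℂ) D E = 0) : D = 0 := by
  have hD : D ∈ traceRadical K := hD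
  have hbot := hK.eq_bot_of_isUnipotent traceFlagFixer_normal isClosed_traceFlagFixer
    isUnipotent_traceFlagFixer
  refine lieAlg_eq_zero_of_apply_one D fun f => ?_
  -- The flag equations cut out the trivial group, and D satisfies them to infinite order since its
  -- powers push each step of the flag into the next. So the derivative at 1 of f - f(1) vanishes
  -- for every f.
  have h := eval_iterate_eq_zero_of_vanishing hK.closed
    (D : Derivation ℂ (coordRing K) (coordRing K)) (traceFlagEquations K) ?_ 1
    (f - algebraMap ℂ _ ((f : K → ℂ) 1)) one_ne_zero ?_ 1
  · rw [Function.iterate_one, map_sub, Derivation.map_algebraMap, sub_zero] at h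
    exact h
  · rintro _ ⟨k, v, hv, l, hl, rfl⟩ m
    cases m with
    | zero =>
      change l (stdRep K 1 v) - l v = 0
      rw [map_one]
      exact sub_self _
    | succ m =>
      rw [Function.iterate_succ_apply, map_sub, Derivation.map_algebraMap, sub_zero,
        ← Function.iterate_succ_apply, iterate_matrixCoeff, matrixCoeff_apply, map_one]
      exact (Submodule.mem_dualAnnihilator l).1 hl _ (pow_apply_mem_traceFlag hD hv m)
  · intro x hx _
    rw [← mem_traceFlagFixer_iff, hbot, Subgroup.mem_bot] at hx
    rw [hx]
    exact sub_self _

end LinAlgGrp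

namespace LinAlgGrp

open Module

attribute [local instance] LieRing.ofAssociativeRing

/-! ### Split parabolic subalgebras -/

section Involution

variable {L : Type*} [LieRing L] [LieAlgebra ℂ L] (f : L →ₗ⁅ℂ⁆ L)

theorem isSolvable_map {b : LieSubalgebra ℂ L} (hb : LieAlgebra.IsSolvable b) :
    LieAlgebra.IsSolvable (b.map f) := by
  have h : b.map f = (f.comp b.incl).range := by
    ext x
    simp
  rw [h]
  infer_instance

theorem IsBorel.map_involution (hf : ∀ x, f (f x) = x) {b : LieSubalgebra ℂ L} (hb : IsBorel b) :
    IsBorel (b.map f) := by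
  have hff : ∀ s : LieSubalgebra ℂ L, (s.map f).map f = s := by
    intro s
    ext x
    simp [hf]
  refine ⟨isSolvable_map f hb.1, fun s hs hbs => ?_⟩
  have h1 : b ≤ s.map f := by
    rw [← hff b]
    exact Submodule.map_mono hbs
  have h2 := hb.2 (isSolvable_map f hs) h1
  rw [← hff s]
  exact Submodule.map_mono h2

theorem IsParabolic.map_involution (hf : ∀ x, f (f x) = x) {q : LieSubalgebra ℂ L}
    (hq : IsParabolic q) : IsParabolic (q.map f) := by
  obtain ⟨b, hb, hbq⟩ := hq
  exact ⟨b.map f, hb.map_involution f hf, Submodule.map_mono hbq⟩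

/-- A split parabolic subalgebra and the fixed points of the involution span the Lie algebra. -/
theorem exists_add_fixed_of_split (M : Type*) [AddCommGroup M] [Module ℂ M] [LieRingModule L M]
    [LieModule ℂ L M] [FiniteDimensional ℂ L] [FiniteDimensional ℂ M]
    (hB : ∀ x, (∀ y, LieModule.traceForm ℂ L M x y = 0) → x = 0) (hf : ∀ x, f (f x) = x)
    {q : LieSubalgebra ℂ L} (hq : IsParabolic q) (h : IsLeviFactor (q ⊓ q.map f) q) (z : L) :
    ∃ x ∈ q, ∃ y, f y = y ∧ z = x + y := by
  have htop : q.toSubmodule ⊔ (q.map f).toSubmodule = ⊤ := by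
    -- A functional vanishing on q + σ(q) is B(x, ·) for some x in both nilpotent radicals; this x
    -- lies in the Levi factor q ∩ σ(q) as well, hence is zero.
    by_contra hne
    obtain ⟨ψ, hψ0, hψ⟩ := Submodule.exists_le_ker_of_lt_top _ (lt_top_iff_ne_top.2 hne)
    have hsurj : Function.Surjective (LieModule.traceForm ℂ L M : L →ₗ[ℂ] Dual ℂ L) := by
      rw [← LinearMap.injective_iff_surjective_of_finrank_eq_finrank Subspace.dual_finrank_eq.symm,
        injective_iff_map_eq_zero]
      exact fun x hx => hB x fun y => congrArg (fun l : Dual ℂ L => l y) hx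
    obtain ⟨x, rfl⟩ := hsurj ψ
    have h1 := hq.mem_nilpotentRadical_of_orthogonal M hB (z := x) fun y hy =>
      hψ (Submodule.mem_sup_left hy)
    have h2 := (hq.map_involution f hf).mem_nilpotentRadical_of_orthogonal M hB (z := x)
      fun y hy => hψ (Submodule.mem_sup_right hy)
    have h3 : x ∈ q ⊓ q.map f := by
      obtain ⟨a, _, ha⟩ := h1
      obtain ⟨b, _, hb⟩ := h2
      exact ⟨ha ▸ a.2, hb ▸ b.2⟩
    have h4 : x = 0 := Submodule.disjoint_def.1 h.1 x h3 h1
    exact hψ0 (by rw [h4, map_zero])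
  obtain ⟨a, ha, b, hb, rfl⟩ := Submodule.mem_sup.1 (htop ▸ Submodule.mem_top : z ∈ _)
  obtain ⟨b, hb, rfl⟩ := hb
  refine ⟨a - b, sub_mem ha hb, b + f b, by rw [map_add, hf, add_comm], ?_⟩
  change a + f b = a - b + (b + f b)
  abel

end Involution

variable {n : ℕ} {K : Subgroup (GL (Fin n) ℂ)}

theorem differential_differential {σ : AlgAut K}
    (hσ : ∀ x : K, σ.toMulEquiv (σ.toMulEquiv x) = x) (D : lieAlg K) :
    differential σ (differential σ D) = D := by
  have h1 : ∀ f, pullback _ σ.regular (pullback _ σ.regular f) = f := fun f => by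
    apply Subtype.ext
    funext x
    simp [pullback_apply, hσ]
  have hs : ∀ x : K, σ.toMulEquiv.symm x = σ.toMulEquiv x := fun x => by
    rw [MulEquiv.symm_apply_eq, hσ]
  have h2 : ∀ f, pullback _ σ.regular_symm (pullback _ σ.regular_symm f) = f := fun f => by
    apply Subtype.ext
    funext x
    simp [pullback_apply, hσ, hs]
  apply Subtype.ext
  apply Derivation.ext
  intro f
  change pullback _ σ.regular_symm (pullback _ σ.regular_symm
    ((D : Derivation ℂ (coordRing K) (coordRing K))
      (pullback _ σ.regular (pullback _ σ.regular f)))) = _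
  rw [h1, h2]

/-! ### The adjoint representation -/

variable (K) in
/-- The adjoint representation. -/
def adRep : Representation ℂ K (lieAlg K) where
  toFun x := (Ad x : lieAlg K →ₗ[ℂ] lieAlg K)
  map_one' := LinearMap.ext fun D => Ad_one D
  map_mul' x y := LinearMap.ext fun D => Ad_mul x y D

theorem adRep_apply (x : K) (D : lieAlg K) : adRep K x D = Ad x D := rfl

/-- The matrix of `Ad x D` is conjugate to the matrix of `D`. -/
theorem lieMatrix_Ad (x : K) (D : lieAlg K) (i j : Fin n) :
    lieMatrix (Ad x D) i j = ∑ k, ∑ l, lieMatrix D k l * (entry K i k x * invEntry K l j x) := by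
  rw [← stdDifferential_single, stdDifferential_Ad, Module.End.mul_apply, Module.End.mul_apply,
    stdRep_apply]
  refine Finset.sum_congr rfl fun k _ => ?_
  rw [stdDifferential_eq, Matrix.toLin'_apply, Matrix.mulVec, dotProduct, Finset.mul_sum]
  refine Finset.sum_congr rfl fun l _ => ?_
  rw [stdRep_apply]
  have : ∑ m, entry K l m x⁻¹ * (Pi.single j 1 : Fin n → ℂ) m = invEntry K l j x := by
    simp [Pi.single_apply, entry, invEntry]
  rw [this]
  ring

/-- The matrix embedding of the Lie algebra is injective, so matrix entries span its dual;
regularity of Ad is thereby reduced to conjugation of matrices. -/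
theorem exists_eq_sum_lieMatrix (l : Dual ℂ (lieAlg K)) :
    ∃ c : Fin n × Fin n → ℂ, ∀ D, l D = ∑ p, c p * lieMatrix D p.1 p.2 := by
  let T : lieAlg K →ₗ[ℂ] (Fin n × Fin n → ℂ) :=
    { toFun := fun D p => lieMatrix D p.1 p.2
      map_add' := fun _ _ => rfl
      map_smul' := fun _ _ => rfl }
  have hT : LinearMap.ker T = ⊥ := by
    rw [LinearMap.ker_eq_bot']
    intro D hD
    apply lieMatrix_injective
    ext i j
    exact congrFun hD (i, j)
  obtain ⟨g, hg⟩ := LinearMap.exists_leftInverse_of_injective T hT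
  refine ⟨fun p => (l ∘ₗ g) (fun r => if p = r then 1 else 0), fun D => ?_⟩
  have h1 : l D = (l ∘ₗ g) (T D) := by
    rw [LinearMap.comp_apply, ← LinearMap.comp_apply g, hg, LinearMap.id_apply]
  rw [h1, LinearMap.pi_apply_eq_sum_univ (l ∘ₗ g)]
  exact Finset.sum_congr rfl fun p _ => mul_comm _ _

/-- The matrix coefficients of the adjoint representation in terms of entries. -/
def adEntry (i j : Fin n) (D : lieAlg K) : coordRing K :=
  ∑ k, ∑ l, lieMatrix D k l • (entryCoord i k * invEntryCoord l j)

theorem adEntry_apply (i j : Fin n) (D : lieAlg K) (x : K) :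
    (adEntry i j D : K → ℂ) x = lieMatrix (Ad x D) i j := by
  rw [lieMatrix_Ad, adEntry]
  simp only [AddSubmonoidClass.coe_finsetSum, Finset.sum_apply]
  exact Finset.sum_congr rfl fun k _ => Finset.sum_congr rfl fun l _ => rfl

set_option maxHeartbeats 1600000 in
variable (K) in
theorem isAlgebraicRep_adRep : IsAlgebraicRep (adRep K) := by
  intro l D
  obtain ⟨c, hc⟩ := exists_eq_sum_lieMatrix l
  have h : (fun x : K => l (adRep K x D)) =
      ∑ p : Fin n × Fin n, c p • (adEntry p.1 p.2 D : K → ℂ) := by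
    funext x
    rw [hc, Finset.sum_apply]
    refine Finset.sum_congr rfl fun p _ => ?_
    change _ = c p * (adEntry p.1 p.2 D : K → ℂ) x
    rw [adEntry_apply, adRep_apply]
  rw [h]
  exact Subalgebra.sum_mem _ fun p _ => (coordRing K).smul_mem (adEntry p.1 p.2 D).2 _

theorem lieMatrix_lie (D E : lieAlg K) :
    lieMatrix ⁅D, E⁆ = lieMatrix D * lieMatrix E - lieMatrix E * lieMatrix D := by
  apply (Matrix.toLin' (R := ℂ) (n := Fin n) (m := Fin n)).injective
  rw [map_sub, Matrix.toLin'_mul, Matrix.toLin'_mul, ← stdDifferential_eq, ← stdDifferential_eq,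
    ← stdDifferential_eq, LieHom.map_lie]
  rfl

/-- The differential of the adjoint representation is the bracket. -/
theorem repDifferential_adRep (D E : lieAlg K) :
    repDifferential (isAlgebraicRep_adRep K) D E = ⁅D, E⁆ := by
  let lieEntry : Fin n → Fin n → Dual ℂ (lieAlg K) := fun i j =>
    { toFun := fun D => lieMatrix D i j
      map_add' := fun _ _ => rfl
      map_smul' := fun _ _ => rfl }
  rw [← sub_eq_zero]
  apply lieMatrix_injective
  ext i j
  change lieEntry i j _ = 0
  have hcoeff : matrixCoeff (isAlgebraicRep_adRep K) (lieEntry i j) E = adEntry i j E := by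
    apply Subtype.ext
    funext x
    rw [adEntry_apply]
    rfl
  rw [map_sub, dual_repDifferential, hcoeff, sub_eq_zero]
  change _ = lieMatrix ⁅D, E⁆ i j
  let ξ : coordRing K →ₗ[ℂ] ℂ := (evalHom (1 : K)).toLinearMap ∘ₗ
    (D : Derivation ℂ (coordRing K) (coordRing K)).toLinearMap
  have hξ1 : ∀ i j, ξ (entryCoord i j) = lieMatrix D i j := fun _ _ => rfl
  have hξ2 : ∀ i j, ξ (invEntryCoord i j) = - lieMatrix D i j := by
    intro i j
    change evalHom (1 : K) ((D : Derivation ℂ (coordRing K) (coordRing K)) (invEntryCoord i j)) = _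
    rw [lieAlg_invEntryCoord, map_neg, map_sum, Finset.sum_eq_single j]
    · rw [map_smul]
      change -(lieMatrix D i j * invEntry K j j 1) = _
      rw [invEntry_one, Matrix.one_apply_eq, mul_one]
    · intro k _ hk
      rw [map_smul]
      change lieMatrix D i k * invEntry K k j 1 = _
      rw [invEntry_one, Matrix.one_apply_ne hk, mul_zero]
    · exact fun h => absurd (Finset.mem_univ j) h
  have hξ : ∀ i j k l, ξ (entryCoord i k * invEntryCoord l j) =
      entry K i k 1 * ξ (invEntryCoord l j) + invEntry K l j 1 * ξ (entryCoord i k) := by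
    intro i j k l
    change evalHom (1 : K) ((D : Derivation ℂ (coordRing K) (coordRing K)) _) = _
    rw [Derivation.leibniz, map_add, smul_eq_mul, smul_eq_mul, map_mul, map_mul]
    rfl
  change ξ (adEntry i j E) = _
  rw [adEntry, map_sum]
  simp only [map_sum, map_smul, hξ, hξ1, hξ2, entry_one, invEntry_one, smul_eq_mul, lieMatrix_lie,
    Matrix.sub_apply, Matrix.mul_apply, Matrix.one_apply, mul_add, Finset.sum_add_distrib]
  simp only [ite_mul, mul_ite, one_mul, zero_mul, mul_zero, Finset.sum_ite_eq',
    Finset.mem_univ, if_true, mul_neg, Finset.sum_neg_distrib]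
  simp only [Finset.sum_ite_irrel, Finset.sum_const_zero, Finset.sum_ite_eq, Finset.mem_univ,
    if_true]
  rw [neg_add_eq_sub]
  congr 1
  exact Finset.sum_congr rfl fun k _ => mul_comm _ _

set_option maxHeartbeats 1600000 in
/-- A subspace which is stable under the normalizer of `q` is stable under `q`. -/
theorem repDifferential_mem_of_normalizer_stable (hK : IsZariskiClosed (K : Set (GL (Fin n) ℂ)))
    {F : Type*} [AddCommGroup F] [Module ℂ F] [FiniteDimensional ℂ F] {ρ : Representation ℂ K F}
    (hρ : IsAlgebraicRep ρ) (q : LieSubalgebra ℂ (lieAlg K)) (W : Submodule ℂ F)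
    (hW : ∀ x ∈ normalizer q, ∀ w ∈ W, ρ x w ∈ W) {D : lieAlg K} (hD : D ∈ q) {w : F}
    (hw : w ∈ W) : repDifferential hρ D w ∈ W := by
  have had := isAlgebraicRep_adRep K
  rw [← Subspace.dualAnnihilator_dualCoannihilator_eq (W := W), Submodule.mem_dualCoannihilator]
  intro l hl
  rw [dual_repDifferential]
  -- These coefficients of Ad are equations of the normalizer, and D in q satisfies them to infinite
  -- order because ad(D) preserves q.
  have key := eval_iterate_eq_zero_of_vanishing hK (D : Derivation ℂ (coordRing K) (coordRing K))
    {f | ∃ m ∈ q.toSubmodule.dualAnnihilator, ∃ E ∈ q, f = matrixCoeff had m E} ?_ 1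
    (matrixCoeff hρ l w) one_ne_zero ?_ 1
  · rwa [Function.iterate_one] at key
  · rintro _ ⟨m, hm, E, hE, rfl⟩ k
    rw [iterate_matrixCoeff, matrixCoeff_apply, map_one]
    refine (Submodule.mem_dualAnnihilator m).1 hm _ ?_
    rw [LieSubalgebra.mem_toSubmodule]
    induction k with
    | zero => exact hE
    | succ k ih =>
      rw [pow_succ', Module.End.mul_apply]
      have h := repDifferential_adRep D ((repDeriv had D ^ k) E)
      rw [repDifferential_apply] at h
      rw [h]
      exact q.lie_mem hD ih
  · intro x hx _
    have hle : q.toSubmodule.map (adRep K x) ≤ q.toSubmodule := by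
      rintro _ ⟨E, hE, rfl⟩
      rw [← Subspace.dualAnnihilator_dualCoannihilator_eq (W := q.toSubmodule),
        Submodule.mem_dualCoannihilator]
      intro m hm
      have := hx (matrixCoeff had m E) ⟨m, hm, E, hE, rfl⟩
      rwa [matrixCoeff_apply] at this
    -- Membership in the normalizer is an equivalence, so Ad(x)q ⊆ q must first be upgraded to
    -- equality by dimension.
    have heq := map_eq_of_le x _ hle
    have hxn : x ∈ normalizer q := by
      refine fun E => ⟨fun hE => hle ⟨E, hE, rfl⟩, fun hE => ?_⟩
      have hE' : Ad x E ∈ q.toSubmodule := hE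
      rw [← heq] at hE'
      obtain ⟨E', hE', h⟩ := hE'
      have h1 := congrArg (Ad x⁻¹) h
      rw [adRep_apply, ← Ad_mul, ← Ad_mul, inv_mul_cancel, Ad_one, Ad_one] at h1
      exact h1 ▸ hE'
    exact (Submodule.mem_dualAnnihilator l).1 hl _ (hW x hxn w hw)

/-! ### Equivariant functionals -/

/-- A functional which is equivariant for an open subgroup of the fixed point group is equivariant
for the fixed points of the differential. -/
theorem exists_smul_of_equivariant (hK : IsZariskiClosed (K : Set (GL (Fin n) ℂ)))
    {F : Type*} [AddCommGroup F] [Module ℂ F] [FiniteDimensional ℂ F] {ρ : Representation ℂ K F}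
    (hρ : IsAlgebraicRep ρ) (σ : AlgAut K) {C : Subgroup K}
    (hC : IsOpenSubgroupOf C (fixedSubgroup σ)) {χ : C →* ℂˣ} (hχ : IsAlgebraicCharacter χ)
    (φ : Dual ℂ F) (hφ : ∀ (c : C) (v : F), φ (ρ (c : K) v) = ((χ c : ℂˣ) : ℂ) * φ v)
    {D : lieAlg K} (hD : differential σ D = D) :
    ∃ a : ℂ, ∀ v, φ (repDifferential hρ D v) = φ v * a := by
  obtain ⟨f₀, hf₀, hχ⟩ := hχ
  let f : coordRing K := ⟨f₀, hf₀⟩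
  obtain ⟨-, O, hO, hCO⟩ := hC
  have h1 : (1 : K) ∈ O := by
    have : (1 : K) ∈ (C : Set K) := C.one_mem
    rw [hCO] at this
    exact this.1
  obtain ⟨g, hg1, hgO⟩ := exists_ne_zero_subset hO h1
  have hDσ : ∀ u, (D : Derivation ℂ (coordRing K) (coordRing K)) (pullback _ σ.regular u) =
      pullback _ σ.regular ((D : Derivation ℂ (coordRing K) (coordRing K)) u) := by
    intro u
    conv_rhs => rw [← hD]
    apply Subtype.ext
    funext x
    change _ = ((D : Derivation ℂ (coordRing K) (coordRing K)) (pullback _ σ.regular u) : K → ℂ)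
      (σ.toMulEquiv.symm (σ.toMulEquiv x))
    rw [MulEquiv.symm_apply_apply]
  refine ⟨((D : Derivation ℂ (coordRing K) (coordRing K)) f : K → ℂ) 1, fun v => ?_⟩
  -- The functions u ∘ σ - u cut out K^σ and vanish along D to infinite order, since D commutes with
  -- σ and σ(1) = 1. The function g restricts to a neighbourhood of 1 in which K^σ lies in C, where
  -- equivariance holds.
  have h := eval_iterate_eq_zero_of_vanishing hK (D : Derivation ℂ (coordRing K) (coordRing K))
    {u | ∃ u₀, u = pullback _ σ.regular u₀ - u₀} ?_ g (matrixCoeff hρ φ v - φ v • f) hg1 ?_ 1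
  · rw [Function.iterate_one, map_sub, Derivation.map_smul] at h
    rw [dual_repDifferential, ← sub_eq_zero]
    exact h
  · rintro _ ⟨u, rfl⟩ k
    have hk : (D : Derivation ℂ (coordRing K) (coordRing K))^[k] (pullback _ σ.regular u - u) =
        pullback _ σ.regular ((D : Derivation ℂ (coordRing K) (coordRing K))^[k] u) -
          (D : Derivation ℂ (coordRing K) (coordRing K))^[k] u := by
      induction k with
      | zero => rfl
      | succ k ih =>
        rw [Function.iterate_succ_apply', ih, map_sub, hDσ, Function.iterate_succ_apply']
    rw [hk]
    change ((D : Derivation ℂ (coordRing K) (coordRing K))^[k] u : K → ℂ) (σ.toMulEquiv 1) -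
      ((D : Derivation ℂ (coordRing K) (coordRing K))^[k] u : K → ℂ) 1 = 0
    rw [map_one, sub_self]
  · intro x hx hgx
    have hxσ : σ.toMulEquiv x = x := by
      apply Subtype.ext
      apply Units.ext
      ext i j
      exact sub_eq_zero.1 (hx _ ⟨entryCoord i j, rfl⟩)
    have hxC : x ∈ (C : Set K) := by
      rw [hCO]
      exact ⟨hgO hgx, hxσ⟩
    change φ (ρ x v) - φ v * f₀ x = 0
    rw [hφ ⟨x, hxC⟩ v, hχ ⟨x, hxC⟩]
    ring

/-- If `q` and `c` span a Lie algebra, the `c`-stable subspace generated by a `q`-stable subspace is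
stable under the whole Lie algebra. -/
theorem apply_mem_sInf_stable {L F : Type*} [LieRing L] [LieAlgebra ℂ L] [AddCommGroup F]
    [Module ℂ F]
    (d : L →ₗ⁅ℂ⁆ End ℂ F) (q c : Set L) (hqc : ∀ z, ∃ x ∈ q, ∃ y ∈ c, z = x + y)
    (W : Submodule ℂ F) (hW : ∀ x ∈ q, ∀ w ∈ W, d x w ∈ W) (z : L) {v : F}
    (hv : v ∈ sInf {N : Submodule ℂ F | W ≤ N ∧ ∀ y ∈ c, ∀ v ∈ N, d y v ∈ N}) :
    d z v ∈ sInf {N : Submodule ℂ F | W ≤ N ∧ ∀ y ∈ c, ∀ v ∈ N, d y v ∈ N} := by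
  set S := {N : Submodule ℂ F | W ≤ N ∧ ∀ y ∈ c, ∀ v ∈ N, d y v ∈ N}
  have hWS : W ≤ sInf S := le_sInf fun N hN => hN.1
  have hcS : ∀ y ∈ c, ∀ v ∈ sInf S, d y v ∈ sInf S := fun y hy v hv =>
    Submodule.mem_sInf.2 fun N hN => hN.2 y hy v (Submodule.mem_sInf.1 hv N hN)
  -- The vectors that all of L sends into the generated subspace contain W and are c-stable, as
  -- d(z)d(y) = d(y)d(z) + d([z, y]). Minimality makes them everything.
  have hM : sInf S ⊓ ⨅ z, (sInf S).comap (d z) ∈ S := by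
    constructor
    · refine le_inf hWS (le_iInf fun z w hw => ?_)
      obtain ⟨x, hx, y, hy, rfl⟩ := hqc z
      rw [Submodule.mem_comap, map_add]
      exact add_mem (hWS (hW x hx w hw)) (hcS y hy w (hWS hw))
    · rintro y hy v ⟨hv, hv'⟩
      have hv' : ∀ z, d z v ∈ sInf S := (Submodule.mem_iInf _).1 hv'
      refine ⟨hcS y hy v hv, (Submodule.mem_iInf _).2 fun z => ?_⟩
      have e : d z (d y v) = d y (d z v) + d ⁅z, y⁆ v := by
        rw [LieHom.map_lie, LieRing.of_associative_ring_bracket, LinearMap.sub_apply,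
          Module.End.mul_apply, Module.End.mul_apply]
        abel
      rw [Submodule.mem_comap, e]
      exact add_mem (hcS y hy _ (hv' z)) (hv' _)
  exact (Submodule.mem_iInf _).1 (Submodule.mem_sInf.1 hv _ hM).2 z

end LinAlgGrp

end

/-! ### Proof of the theorem -/

open LinAlgGrp

theorem lemma2 {n : ℕ} (K : Subgroup (Matrix.GeneralLinearGroup (Fin n) ℂ))
    (hK : LinAlgGrp.IsReductive K)
    (σ : LinAlgGrp.AlgAut K) (hσ : ∀ x : K, σ.toMulEquiv (σ.toMulEquiv x) = x)
    (C : Subgroup K) (hC : LinAlgGrp.IsOpenSubgroupOf C (LinAlgGrp.fixedSubgroup σ))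
    (hCK : LinAlgGrp.MeetsEveryComponent C)
    (q : LieSubalgebra ℂ (LinAlgGrp.lieAlg K)) (hq : LinAlgGrp.IsSplitParabolic σ q)
    (F : Type*) [AddCommGroup F] [Module ℂ F] [FiniteDimensional ℂ F]
    (ρ : Representation ℂ K F) (hρ : LinAlgGrp.IsAlgebraicRep ρ) (hirr : ρ.IsIrreducible)
    (χ : C →* ℂˣ) (hχ : LinAlgGrp.IsAlgebraicCharacter χ)
    (φ : F →ₗ[ℂ] ℂ) (hφ : ∀ (c : C) (v : F), φ (ρ (c : K) v) = ((χ c : ℂˣ) : ℂ) * φ v)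
    (hφ0 : φ ≠ 0) :
    ∃ v : F, (∀ u ∈ LinAlgGrp.unipotentRadical (LinAlgGrp.normalizer q), ρ u v = v) ∧
      φ v ≠ 0 := by
  by_contra! hcon
  have : Nontrivial F := by
    by_contra hF
    rw [not_nontrivial_iff_subsingleton] at hF
    exact hφ0 (LinearMap.ext fun v => by rw [Subsingleton.elim v 0, map_zero, map_zero])
  obtain ⟨W, hW0, hWs, hWu⟩ := exists_stable_fixed_unipotentRadical hρ (normalizer q)
  have hφW : W ≤ LinearMap.ker φ := fun w hw => hcon w fun u hu => hWu u hu w hw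
  let _ := stdLieRingModule K
  have := stdLieModule K
  have hqc : ∀ z : lieAlg K, ∃ x ∈ (q : Set (lieAlg K)),
      ∃ y ∈ {y : lieAlg K | differential σ y = y}, z = x + y :=
    exists_add_fixed_of_split (differential σ) (Fin n → ℂ) hK.traceForm_nondegenerate
      (differential_differential hσ) hq.1 hq.2.1
  let M := sInf {N : Submodule ℂ F | W ≤ N ∧ ∀ y ∈ {y : lieAlg K | differential σ y = y},
    ∀ v ∈ N, repDifferential hρ y v ∈ N}
  have hM : ∀ D : lieAlg K, ∀ v ∈ M, repDifferential hρ D v ∈ M := fun D v hv =>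
    apply_mem_sInf_stable (repDifferential hρ) q _ hqc W (fun x hx w hw =>
      repDifferential_mem_of_normalizer_stable hK.closed hρ q W hWs hx hw) D hv
  have hWM : W ≤ M := le_sInf fun N hN => hN.1
  have hφM : M ≤ LinearMap.ker φ := sInf_le ⟨hφW, fun y hy v hv => by
    obtain ⟨a, ha⟩ := exists_smul_of_equivariant hK.closed hρ σ hC hχ φ hφ hy
    rw [LinearMap.mem_ker, ha, LinearMap.mem_ker.1 hv, zero_mul]⟩
  have hφKM : ∀ x : K, ∀ m ∈ M, φ (ρ x m) = 0 := by
    intro x m hm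
    obtain ⟨c, hc, hcx⟩ := hCK x
    -- Writing m = ρ(x⁻¹c)m' with m' in M gives φ(ρ(x)m) = φ(ρ(c)m') = χ(c)φ(m') = 0.
    rw [← map_eq_of_mem_connectedComponent hρ M hM x c hcx] at hm
    obtain ⟨m', hm', rfl⟩ := hm
    rw [← Module.End.mul_apply, ← map_mul, mul_inv_cancel_left, hφ ⟨c, hc⟩,
      LinearMap.mem_ker.1 (hφM hm'), mul_zero]
  -- The largest subrepresentation inside ker φ.
  let P : Subrepresentation ρ :=
    { toSubmodule := ⨅ x, LinearMap.ker (φ ∘ₗ ρ x)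
      apply_mem_toSubmodule := fun g v hv => by
        rw [Submodule.mem_iInf] at hv ⊢
        intro x
        have := hv (x * g)
        rwa [map_mul] at this }
  have hMP : M ≤ P.toSubmodule := fun m hm => (Submodule.mem_iInf _).2 fun x => hφKM x m hm
  rcases hirr.eq_bot_or_eq_top P with hP | hP
  · rw [hP] at hMP
    exact hW0 (eq_bot_iff.2 (hWM.trans hMP))
  · refine hφ0 (LinearMap.ext fun v => ?_)
    have hv : v ∈ P.toSubmodule := by rw [hP]; exact Submodule.mem_top
    have := (Submodule.mem_iInf _).1 hv 1
    rwa [LinearMap.mem_ker, map_one] at this
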